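/- Let $(\Omega,\mathbb T,\mu)$ be a complete measure space with $\mu$ positive and $\sigma$-finite, let $E$ be a separable real Banach space with dual $E^*$, and let $f:\Omega\times E\to\overline{\mathbb R}$ be $\mathbb T\otimes\mathcal B(E)$-measurable. For $v:\Omega\to\overline{\mathbb R}$ let $\int^*_\Omega v\,d\mu=\inf\{\int_\Omega u\,d\mu : u\in L_1(\Omega,\mathbb R),\ u\ge v\ \mu\text{-a.e.}\}$ be the upper integral, and put $I_f(x)=\int^*_\Omega f(\omega,x(\omega))\,d\mu(\omega)$ for $x\in L_1(\Omega,E)$. Let $x_0\in L_1(\Omega,E)$ be such that $I_f(x_0)$ is finite. Let $x^*\in L_\infty(\Omega,E^*_{\sigma^*})$, that is, $x^*:\Omega\to E^*$, the function $\omega\mapsto\langle x^*(\omega),e\rangle$ is measurable for every $e\in E$, and $\|x^*\|_*\in L_\infty(\Omega,\mathbb R)$. For a function $g$ with values in $\overline{\mathbb R}$, finite at $a$, write $[g](a,e,r)=r^{-1}(g(a+re)-g(a))$ for $r>0$; for an integrand $g$, $[g](x_0,e,r)$ is the function $\omega\mapsto[g(\omega,\cdot)](x_0(\omega),e,r)$.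 The function $x^*$ is called a weak Hadamard subderivative of $I_f$ at $x_0$ on $L_1(\Omega,E)$ if $x\mapsto\langle x^*,x\rangle=\int_\Omega\langle x^*(\omega),x(\omega)\rangle\,d\mu(\omega)$ is a continuous linear functional on $L_1(\Omega,E)$ and, for every sequentially relatively weakly compact set $X\subset L_1(\Omega,E)$, $$\liminf_{r\to0_+}\ \inf_{x\in X}\big([I_f](x_0,x,r)-\langle x^*,x\rangle\big)\ \ge\ 0 .$$ For an integrable function $\alpha:\Omega\to(0,\infty)$, an $\alpha$-Young integrand is a function of the form $\phi(\omega,e)=\alpha(\omega)\,\psi(\alpha(\omega)^{-1}\|e\|)$, where $\psi:[0,\infty)\to[0,\infty)$ is nondecreasing and convex, $\psi(0)=0$ and $\lim_{t\to\infty}\psi(t)/t=+\infty$. Let $(\mathrm G_\alpha)$ be the following condition: for every $\alpha$-Young integrand $\phi$ and every $\varepsilon>0$ there is a family $(u_r)_{r>0}$ of real functions on $\Omega$ which are, for all sufficiently small $r>0$, nonnegative a.e. and integrable, such that $\lim_{r\to0_+}\|u_r\|_1=0$ and, for all sufficiently small $r>0$, there is a negligible set $N_r$ with $$[f-\langle x^*,\cdot\rangle](x_0,e,r)(\omega)\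 \ge\ -\varepsilon\,\phi(\omega,e)-u_r(\omega)\qquad\text{for all }\omega\in\Omega\setminus N_r,\ e\in E .$$ Consider the assertions: $(a)$ $x^*$ is a weak Hadamard subderivative of $I_f$ at $x_0$ on $L_1(\Omega,E)$; $(b)$ $(\mathrm G_\alpha)$ holds for every integrable $\alpha:\Omega\to(0,\infty)$; $(b')$ $(\mathrm G_\alpha)$ holds for some integrable $\alpha:\Omega\to(0,\infty)$. Then $(b)\Rightarrow(a)$ and $(b')\Rightarrow(a)$. If moreover $E$ is reflexive and $\mu$ is atomless (every measurable set of positive measure contains a measurable subset $B$ such that both $B$ and its complement in the set have positive measure), then $(a)\Leftrightarrow(b)$ and $(a)\Leftrightarrow(b')$. -/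

import Mathlib

open MeasureTheory Filter Topology Set
open scoped ENNReal

namespace WeakHadamard

/-- The difference quotient `[g](x₀, x, r) = r⁻¹ (g (x₀ + r x) - g x₀)` of an extended real valued
function. It is only used for `r > 0` and `g x₀` finite. -/
noncomputable def diffQuot {X : Type*} [AddCommGroup X] [Module ℝ X]
    (g : X → EReal) (x₀ x : X) (r : ℝ) : EReal :=
  ((r⁻¹ : ℝ) : EReal) * (g (x₀ + r • x) - g x₀)

/-- The upper integral of an extended real valued map `v`:
the infimum of `∫ u` over all real integrable `u` with `v ≤ u` almost everywhere. -/
noncomputable def upperIntegral {Ω : Type*} [MeasurableSpace Ω] (μ : Measure Ω)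
    (v : Ω → EReal) : EReal :=
  ⨅ (u : Ω → ℝ) (_ : Integrable u μ) (_ : ∀ᵐ ω ∂μ, v ω ≤ ((u ω : ℝ) : EReal)),
    ((∫ ω, u ω ∂μ : ℝ) : EReal)

/-- The integral functional `I_f` on `L¹(Ω, E)` of an integrand `f : Ω → E → [-∞, ∞]`. -/
noncomputable def integralFunctional {Ω E : Type*} [MeasurableSpace Ω] (μ : Measure Ω)
    [NormedAddCommGroup E] (f : Ω → E → EReal) (x : Lp E 1 μ) : EReal :=
  upperIntegral μ (fun ω => f ω (x ω))

/-- `xs` represents an element of `L^∞(Ω, E*_{σ*})`: it is scalarly measurable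
and its dual norm is essentially bounded. -/
def MemLinftyWeakStar {Ω E : Type*} [MeasurableSpace Ω] (μ : Measure Ω)
    [NormedAddCommGroup E] [NormedSpace ℝ E] (xs : Ω → StrongDual ℝ E) : Prop :=
  (∀ e : E, Measurable fun ω => xs ω e) ∧ MemLp (fun ω => ‖xs ω‖) ∞ μ

/-- The weak Hadamard bornology of a normed space: the family of its sequentially relatively
weakly compact subsets. -/
def weakHadamardBornology (X : Type*) [NormedAddCommGroup X] [NormedSpace ℝ X] : Set (Set X) :=
  {S | ∀ u : ℕ → X, (∀ n, u n ∈ S) → ∃ (x : X) (s : ℕ → ℕ), StrictMono s ∧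
    Tendsto (fun k => toWeakSpace ℝ X (u (s k))) atTop (𝓝 (toWeakSpace ℝ X x))}

/-- `ℓ` is a subderivative of `F` at `x₀` with respect to the family `𝓑` of subsets of `X`:
for all `S ∈ 𝓑`, `liminf_{r → 0+} inf_{x ∈ S} ([F](x₀, x, r) - ℓ x) ≥ 0`. -/
def IsSubderivative {X : Type*} [NormedAddCommGroup X] [NormedSpace ℝ X] (𝓑 : Set (Set X))
    (F : X → EReal) (x₀ : X) (ℓ : StrongDual ℝ X) : Prop :=
  ∀ S ∈ 𝓑, (0 : EReal) ≤
    liminf (fun r : ℝ => ⨅ x ∈ S, (diffQuot F x₀ x r - ((ℓ x : ℝ) : EReal))) (𝓝[>] (0 : ℝ))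

/-- `xs` is a weak Hadamard subderivative of `I_f` at `x₀` on `L¹(Ω, E)`: the pairing
`x ↦ ∫ ⟨xs, x⟩ dμ` is a continuous linear functional on `L¹(Ω, E)`, and it is a subderivative of
`I_f` at `x₀` for the weak Hadamard bornology. -/
def IsWeakHadamardSubderivative {Ω E : Type*} [MeasurableSpace Ω] (μ : Measure Ω)
    [NormedAddCommGroup E] [NormedSpace ℝ E] (f : Ω → E → EReal) (x₀ : Lp E 1 μ)
    (xs : Ω → StrongDual ℝ E) : Prop :=
  ∃ ℓ : StrongDual ℝ (Lp E 1 μ), (∀ x : Lp E 1 μ, ℓ x = ∫ ω, xs ω (x ω) ∂μ) ∧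
    IsSubderivative (weakHadamardBornology (Lp E 1 μ)) (integralFunctional μ f) x₀ ℓ

/-- `φ` is an `α`-Young integrand: `φ(ω, e) = α(ω) ψ(α(ω)⁻¹ ‖e‖)` for some nondecreasing convex
`ψ : [0, ∞) → [0, ∞)` with `ψ 0 = 0` and `ψ t / t → ∞` as `t → ∞`. -/
def IsAlphaYoung {Ω E : Type*} [NormedAddCommGroup E] (α : Ω → ℝ) (φ : Ω → E → ℝ) : Prop :=
  ∃ ψ : ℝ → ℝ, (∀ t, 0 ≤ t → 0 ≤ ψ t) ∧ ψ 0 = 0 ∧ MonotoneOn ψ (Ici 0) ∧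
    ConvexOn ℝ (Ici 0) ψ ∧ Tendsto (fun t => ψ t / t) atTop atTop ∧
    ∀ ω e, φ ω e = α ω * ψ ((α ω)⁻¹ * ‖e‖)

/-- The growth condition attached to `α`: for every `α`-Young integrand `φ` and every `ε > 0`
there is a family `(u_r)_{r>0}` of real functions, eventually nonnegative and integrable as
`r → 0+`, with `‖u_r‖₁ → 0` and, eventually, `[f - ⟨xs, ·⟩](x₀, ·, r) ≥ -ε φ - u_r`
off a negligible subset of `Ω`. -/
def GrowthCondition {Ω E : Type*} [MeasurableSpace Ω] (μ : Measure Ω)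
    [NormedAddCommGroup E] [NormedSpace ℝ E] (f : Ω → E → EReal) (x₀ : Lp E 1 μ)
    (xs : Ω → StrongDual ℝ E) (α : Ω → ℝ) : Prop :=
  ∀ φ : Ω → E → ℝ, IsAlphaYoung α φ → ∀ ε : ℝ, 0 < ε →
    ∃ u : ℝ → Ω → ℝ,
      (∀ᶠ r in 𝓝[>] (0 : ℝ), Integrable (u r) μ ∧ ∀ᵐ ω ∂μ, 0 ≤ u r ω) ∧
      Tendsto (fun r => eLpNorm (u r) 1 μ) (𝓝[>] (0 : ℝ)) (𝓝 0) ∧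
      ∀ᶠ r in 𝓝[>] (0 : ℝ), ∀ᵐ ω ∂μ, ∀ e : E,
        ((-(ε * φ ω e) - u r ω : ℝ) : EReal) ≤
          diffQuot (fun e' => f ω e' - ((xs ω e' : ℝ) : EReal)) (x₀ ω) e r

/-- `μ` has no atoms in the measure-theoretic sense: every measurable set of positive measure
splits into two measurable parts of positive measure. -/
def IsAtomless {Ω : Type*} [MeasurableSpace Ω] (μ : Measure Ω) : Prop :=
  ∀ A, MeasurableSet A → μ A ≠ 0 →
    ∃ B, B ⊆ A ∧ MeasurableSet B ∧ μ B ≠ 0 ∧ μ (A \ B) ≠ 0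

/-- A normed space is reflexive if the canonical map into its bidual is onto. -/
def IsReflexiveSpace (E : Type*) [NormedAddCommGroup E] [NormedSpace ℝ E] : Prop :=
  Function.Surjective (NormedSpace.inclusionInDoubleDual ℝ E)

end WeakHadamard

/-! Both directions compare weakly compact sets with sublevel sets of Young functionals `x ↦ ∫ φ(ω,
x(ω)) dμ`.

Sufficiency: a sequentially relatively weakly compact `S` in `L¹` is uniformly integrable relative
to the weight `α`. Otherwise a gliding hump contradicts weak convergence
(`false_of_weakly_null_of_le_norm_proj`). De la Vallée-Poussin's construction then gives a Young
function whose functional is at most `2` on `S`. Integrating the growth inequality along `x ∈ S`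
gives `[I_f](x₀, x, r) - ⟨xs, x⟩ ≥ -2ε - ‖u_r‖₁`.

Necessity: for reflexive `E` the set `{∫ φ ≤ 1}` is sequentially relatively weakly compact
(Dunford-Pettis), so for small `r` the functional's quotient exceeds `⟨xs, x⟩ - δ` on it. Let `g ≥
0` measure by how much `-εφ` fails as a lower bound for the integrand's quotient along some
measurable `x`. Then `∫ g ≤ δ` whenever `δ < ε`. If not, restrict `x` to a set `B` on which
everything is integrable and `∫_B φ ≤ 1`. Either `∫_B g > δ` already, or atomlessness allows `∫_B φ
= 1`, and the term `ε` alone beats `δ`. Such gaps `g` are stable under maxima, so they have a common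
a.e. bound `u` with `∫ u ≤ δ`. Measurable selection turns this bound along all measurable `x` into
an inequality for all `e` off one null set. -/

namespace WeakHadamard

/-! ### Measurable selection through analytic sets. -/

section Selection

/-- A measurable subset of a product only involves countably many measurable subsets of the first
factor, so that it is the preimage of a measurable subset of `ℝ × E`. -/
theorem exists_eq_preimage_prodMap {Ω E : Type*} [MeasurableSpace Ω] [MeasurableSpace E]
    {B : Set (Ω × E)} (hB : MeasurableSet B) :
    ∃ (p : Ω → ℝ) (B' : Set (ℝ × E)), Measurable p ∧ MeasurableSet B' ∧
      B = Prod.map p id ⁻¹' B' := by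
  classical
  rw [← generateFrom_prod] at hB
  induction B, hB using MeasurableSpace.generateFrom_induction with
  | hC t ht _ =>
    obtain ⟨A, hA, F, hF, rfl⟩ := ht
    refine ⟨A.indicator 1, {1} ×ˢ F, measurable_one.indicator hA,
      (measurableSet_singleton _).prod hF, ?_⟩
    ext ⟨ω, e⟩
    by_cases h : ω ∈ A <;> simp [h]
  | empty => exact ⟨0, ∅, measurable_zero, .empty, by simp⟩
  | compl t _ ih =>
    obtain ⟨p, B', hp, hB', rfl⟩ := ih
    exact ⟨p, B'ᶜ, hp, hB'.compl, rfl⟩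
  | iUnion s _ ih =>
    choose p B' hp hB' h using ih
    -- Countably many real parameters are packed into one: `ℕ → ℝ` embeds measurably in `ℝ`, and `g`
    -- is a measurable left inverse.
    have hj := measurableEmbedding_embeddingReal (ℕ → ℝ)
    obtain ⟨g, hg, hgj⟩ := hj.exists_measurable_extend (g := (id : (ℕ → ℝ) → ℕ → ℝ))
      measurable_id fun _ => ⟨0⟩
    refine ⟨fun ω => embeddingReal (ℕ → ℝ) fun n => p n ω,
      ⋃ n, (fun q : ℝ × E => (g q.1 n, q.2)) ⁻¹' B' n,
      hj.measurable.comp (measurable_pi_lambda _ hp), .iUnion fun n => ?_, ?_⟩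
    · exact (((measurable_pi_apply n).comp (hg.comp measurable_fst)).prodMk measurable_snd) (hB' n)
    · rw [preimage_iUnion]
      refine iUnion_congr fun n => ?_
      rw [h n]
      ext ⟨ω, e⟩
      have := congrFun hgj fun n => p n ω
      simp only [Function.comp_apply, id_eq] at this
      simp [this]

/-- Inner approximation of the measure of a continuous image of the Baire space by the measure of
the images of compact subsets. -/
theorem exists_isCompact_le_measure_image {X : Type*} [TopologicalSpace X]
    [MeasurableSpace X] (ν : Measure X) [ν.OuterRegular] {k : (ℕ → ℕ) → X} (hk : Continuous k)
    {c : ℝ≥0∞} (hc : c < ν (range k)) : ∃ K, IsCompact K ∧ c ≤ ν (k '' K) := by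
  -- Coordinates are capped one at a time. Continuity along increasing unions holds for arbitrary
  -- sets, so the measurability of `k '' V` plays no role.
  have step : ∀ (n : ℕ) (V : {V : Set (ℕ → ℕ) // c < ν (k '' V)}),
      ∃ m, c < ν (k '' (V ∩ {s | s n ≤ m})) := by
    intro n V
    have hmono : Monotone fun m => k '' ((V : Set (ℕ → ℕ)) ∩ {s | s n ≤ m}) := fun a b hab =>
      image_mono (inter_subset_inter_right _ fun s hs => by
        simp only [mem_ofPred_eq] at hs ⊢; omega)
    have hU : ⋃ m, k '' ((V : Set (ℕ → ℕ)) ∩ {s | s n ≤ m}) = k '' V := by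
      rw [← image_iUnion, ← inter_iUnion]
      congr 1
      refine inter_eq_left.2 fun s _ => mem_iUnion.2 ⟨s n, by simp⟩
    have h2 := V.2
    rw [← hU, hmono.measure_iUnion] at h2
    exact lt_iSup_iff.1 h2
  choose m hm using step
  let W : ℕ → {V : Set (ℕ → ℕ) // c < ν (k '' V)} := fun n =>
    Nat.rec ⟨univ, by rwa [image_univ]⟩ (fun n V => ⟨V.1 ∩ {s | s n ≤ m n V}, hm n V⟩) n
  let b : ℕ → ℕ := fun n => m n (W n)
  have hW : ∀ n, (W n).1 = {s | ∀ i < n, s i ≤ b i} := by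
    intro n
    induction n with
    | zero => simp [W]
    | succ n ih =>
      have : (W (n + 1)).1 = (W n).1 ∩ {s | s n ≤ b n} := rfl
      rw [this, ih]
      ext s
      simp only [mem_inter_iff, mem_ofPred_eq]
      constructor
      · rintro ⟨h1, h2⟩ i hi
        rcases Nat.lt_succ_iff_lt_or_eq.1 hi with h | rfl
        exacts [h1 i h, h2]
      · exact fun h => ⟨fun i hi => h i (by omega), h n (by omega)⟩
  have hK : IsCompact (univ.pi fun i => Iic (b i)) :=
    isCompact_univ_pi fun i => (finite_Iic (b i)).isCompact
  refine ⟨_, hK, ?_⟩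
  rw [measure_eq_iInf_isOpen]
  refine le_iInf₂ fun O hO => le_iInf fun hOo => ?_
  suffices h : ∃ n, (W n).1 ⊆ k ⁻¹' O by
    obtain ⟨n, hn⟩ := h
    exact (W n).2.le.trans (measure_mono (image_subset_iff.2 hn))
  by_contra! hcon
  have : ∀ n, ∃ s, (∀ i < n, s i ≤ b i) ∧ k s ∉ O := by
    intro n
    obtain ⟨s, hs, hs'⟩ := not_subset.1 (hcon n)
    rw [hW] at hs
    exact ⟨s, hs, hs'⟩
  choose s hs hsO using this
  -- `s n` obeys only the first `n` caps, so it is truncated to enter the compact box. Each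
  -- coordinate is eventually unaffected, hence the original points have the same limit.
  obtain ⟨t, ht, φ, hφ, hlim⟩ := hK.tendsto_subseq
    (x := fun n i => min (s n i) (b i)) fun n i _ => mem_Iic.2 (min_le_right _ _)
  have hlim' : Tendsto (fun n => s (φ n)) atTop (𝓝 t) := by
    rw [tendsto_pi_nhds] at hlim ⊢
    intro i
    refine (hlim i).congr' ?_
    filter_upwards [eventually_gt_atTop i] with n hn
    exact min_eq_left (hs _ i (hn.trans_le hφ.le_apply))
  have hmem : k t ∈ O := hO (mem_image_of_mem k ht)
  obtain ⟨n, hn⟩ := ((hk.tendsto t).comp hlim' |>.eventually (hOo.mem_nhds hmem)).exists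
  exact hsO _ hn

/-- The Baire space embeds continuously in the real line. -/
theorem exists_continuous_injective_baire_real :
    ∃ j : (ℕ → ℕ) → ℝ, Continuous j ∧ Function.Injective j := by
  -- A sequence is coded by the indicator of its graph, and the Cantor space sits in `ℝ`.
  let a : (ℕ → ℕ) → (ℕ → Bool) := fun z n => decide (z n.unpair.1 = n.unpair.2)
  have ha : Continuous a := continuous_pi fun n =>
    (continuous_of_discreteTopology (f := fun m : ℕ => decide (m = n.unpair.2))).comp
      (continuous_apply n.unpair.1)
  have hai : Function.Injective a := by
    intro z w h
    ext n
    have := congrFun h (Nat.pair n (z n))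
    simp only [a, Nat.unpair_pair, decide_true] at this
    exact (of_decide_eq_true this.symm).symm
  exact ⟨fun z => cantorSetHomeomorphNatToBool.symm (a z),
    continuous_subtype_val.comp (cantorSetHomeomorphNatToBool.symm.continuous.comp ha),
    Subtype.val_injective.comp (cantorSetHomeomorphNatToBool.symm.injective.comp hai)⟩

/-- A continuous map from a compact subset of the Baire space has a Borel section. -/
theorem exists_measurable_section {X : Type*} [TopologicalSpace X] [T2Space X]
    [MeasurableSpace X] [BorelSpace X] {k : (ℕ → ℕ) → X} (hk : Continuous k)
    {K : Set (ℕ → ℕ)} (hK : IsCompact K) :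
    ∃ s : X → ℕ → ℕ, Measurable s ∧ ∀ c ∈ k '' K, k (s c) = c := by
  classical
  obtain ⟨j, hj, hji⟩ := exists_continuous_injective_baire_real
  obtain ⟨g, hg, hgj⟩ := (hj.measurableEmbedding hji).exists_measurable_extend
    (g := (id : (ℕ → ℕ) → ℕ → ℕ)) measurable_id fun _ => ⟨0⟩
  -- The fibre over `c` is a compact set of reals after coding; the section picks its minimum.
  let T : X → Set ℝ := fun c => j '' (K ∩ k ⁻¹' {c})
  have hT : ∀ c, IsCompact (T c) := fun c =>
    (hK.inter_right (isClosed_singleton.preimage hk)).image hj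
  have hTne : ∀ c ∈ k '' K, (T c).Nonempty := by
    rintro _ ⟨z, hz, rfl⟩
    exact ⟨_, mem_image_of_mem j ⟨hz, rfl⟩⟩
  have hD : MeasurableSet (k '' K) := (hK.image hk).isClosed.measurableSet
  let m : X → ℝ := fun c => sInf (T c)
  have hm : Measurable m := by
    refine measurable_of_Iic fun a => ?_
    -- A sublevel set of `m` is a compact image, up to the convention `sInf ∅ = 0` off `k '' K`.
    have : m ⁻¹' Iic a = k '' (K ∩ j ⁻¹' Iic a) ∪ ((k '' K)ᶜ ∩ {_c | (0 : ℝ) ≤ a}) := by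
      ext c
      by_cases hc : c ∈ k '' K
      · simp only [mem_preimage, mem_Iic, mem_union, mem_inter_iff, mem_compl_iff, hc,
          not_true_eq_false, false_and, or_false]
        constructor
        · intro h
          obtain ⟨z, ⟨hz, hzc⟩, hzm⟩ := (hT c).sInf_mem (hTne c hc)
          exact ⟨z, ⟨hz, show j z ≤ a from hzm.trans_le h⟩, hzc⟩
        · rintro ⟨z, ⟨hz, hza⟩, rfl⟩
          exact (csInf_le (hT _).bddBelow (mem_image_of_mem j ⟨hz, rfl⟩)).trans hza
      · have h0 : m c = 0 := by
          have : T c = ∅ := by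
            rw [image_eq_empty, eq_empty_iff_forall_notMem]
            rintro z ⟨hz, rfl⟩
            exact hc (mem_image_of_mem k hz)
          simp [m, this]
        have h1 : c ∉ k '' (K ∩ j ⁻¹' Iic a) := fun h => hc (image_mono inter_subset_left h)
        simp only [mem_preimage, h0, mem_Iic, mem_union, h1, mem_inter_iff, mem_compl_iff, hc,
          mem_ofPred_eq, false_or, not_false_eq_true, true_and]
    rw [this]
    exact ((hK.inter_right (isClosed_Iic.preimage hj)).image hk).isClosed.measurableSet.union
      (hD.compl.inter (.const _))
  refine ⟨g ∘ m, hg.comp hm, fun c hc => ?_⟩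
  obtain ⟨z, ⟨-, hzc⟩, hzm⟩ := (hT c).sInf_mem (hTne c hc)
  have : g (j z) = z := congrFun hgj z
  simp only [Function.comp_apply, m, ← hzm, this]
  exact hzc

/-- Measurable selection: if a measurable subset `B` of `Ω × E`, with `E` Polish, has a
non-negligible projection on `Ω`, then some measurable map `x : Ω → E` satisfies
`(ω, x ω) ∈ B` on a set of positive measure. -/
theorem exists_measurable_selection {Ω E : Type*} [MeasurableSpace Ω] (μ : Measure Ω)
    [IsFiniteMeasure μ] [TopologicalSpace E] [PolishSpace E] [MeasurableSpace E] [BorelSpace E]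
    {B : Set (Ω × E)} (hB : MeasurableSet B) (hpos : μ (Prod.fst '' B) ≠ 0) :
    ∃ x : Ω → E, Measurable x ∧ μ {ω | (ω, x ω) ∈ B} ≠ 0 := by
  obtain ⟨p, B', hp, hB', rfl⟩ := exists_eq_preimage_prodMap hB
  let ν := μ.map p
  have hsub : Prod.fst '' (Prod.map p id ⁻¹' B') ⊆ p ⁻¹' (Prod.fst '' B') := by
    rintro _ ⟨⟨ω, e⟩, h, rfl⟩
    exact ⟨_, h, rfl⟩
  have hν : ν (Prod.fst '' B') ≠ 0 := by
    intro h0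
    refine hpos (measure_mono_null (hsub.trans (preimage_mono (subset_toMeasurable ν _))) ?_)
    rw [← Measure.map_apply hp (measurableSet_toMeasurable _ _)]
    exact (measure_toMeasurable _).trans h0
  -- `B'` is a continuous image of the Baire space. A Borel section of its first coordinate, defined
  -- over a large compact part, supplies the second coordinate.
  have hA := hB'.analyticSet
  rw [AnalyticSet] at hA
  rcases hA with rfl | ⟨h, hh, rfl⟩
  · simp at hν
  rw [← range_comp] at hν
  have hk : Continuous (Prod.fst ∘ h) := continuous_fst.comp hh
  obtain ⟨c, hc0, hc⟩ := exists_between (pos_iff_ne_zero.2 hν)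
  obtain ⟨K, hK, hcK⟩ := exists_isCompact_le_measure_image ν hk hc
  obtain ⟨s, hs, hsK⟩ := exists_measurable_section hk hK
  refine ⟨fun ω => (h (s (p ω))).2, measurable_snd.comp (hh.measurable.comp (hs.comp hp)), ?_⟩
  have hcK' : c ≤ μ (p ⁻¹' ((Prod.fst ∘ h) '' K)) := by
    rwa [← Measure.map_apply hp (hK.image hk).isClosed.measurableSet]
  refine (hc0.trans_le (hcK'.trans (measure_mono fun ω hω => ?_))).ne'
  exact ⟨s (p ω), Prod.ext (hsK _ hω) rfl⟩

/-- If no measurable map `x : Ω → E` meets the measurable set `B` with positive measure,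
then almost every fibre of `B` is empty. -/
theorem ae_forall_notMem_of_selection {Ω E : Type*} [MeasurableSpace Ω] (μ : Measure Ω)
    [SigmaFinite μ] [TopologicalSpace E] [PolishSpace E] [MeasurableSpace E] [BorelSpace E]
    {B : Set (Ω × E)} (hB : MeasurableSet B)
    (h : ∀ x : Ω → E, Measurable x → ∀ᵐ ω ∂μ, (ω, x ω) ∉ B) :
    ∀ᵐ ω ∂μ, ∀ e, (ω, e) ∉ B := by
  have hμ : μ ≪ μ.toFinite := absolutelyContinuous_toFinite μ
  suffices H : ∀ᵐ ω ∂μ.toFinite, ∀ e, (ω, e) ∉ B from hμ.ae_le H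
  rw [ae_iff]
  by_contra hne
  have : {ω | ¬ ∀ e, (ω, e) ∉ B} = Prod.fst '' B := by
    ext ω; simp
  rw [this] at hne
  obtain ⟨x, hx, hx0⟩ := exists_measurable_selection μ.toFinite hB hne
  refine hx0 ?_
  have H : ∀ᵐ ω ∂μ.toFinite, (ω, x ω) ∉ B := (toFinite_absolutelyContinuous μ).ae_le (h x hx)
  simpa [ae_iff] using H

end Selection


/-! ### Essential suprema of directed families. -/

section EssSup

/-- A family of measurable functions, directed upwards and with bounded integrals, has an
integrable almost everywhere upper bound with the same bound of the integral. -/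
theorem exists_measurable_ae_upperBound {Ω : Type*} [MeasurableSpace Ω] (μ : Measure Ω)
    {V : Set (Ω → ℝ≥0∞)} (hne : V.Nonempty) (hmeas : ∀ v ∈ V, Measurable v)
    (hsup : ∀ v ∈ V, ∀ w ∈ V, v ⊔ w ∈ V) {C : ℝ≥0∞} (hC : C ≠ ∞)
    (hle : ∀ v ∈ V, ∫⁻ ω, v ω ∂μ ≤ C) :
    ∃ u : Ω → ℝ≥0∞, Measurable u ∧ ∫⁻ ω, u ω ∂μ ≤ C ∧ ∀ v ∈ V, v ≤ᵐ[μ] u := by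
  obtain ⟨a, ha, halim, haV⟩ := exists_seq_tendsto_sSup
    (hne.image fun v => ∫⁻ ω, v ω ∂μ) (OrderTop.bddAbove _)
  choose v hv hva using haV
  set s := sSup ((fun v => ∫⁻ ω, v ω ∂μ) '' V) with hs
  have hle' : ∀ v ∈ V, ∫⁻ ω, v ω ∂μ ≤ s := fun v hv => le_sSup (mem_image_of_mem _ hv)
  have hsC : s ≤ C := sSup_le (by rintro _ ⟨v, hv, rfl⟩; exact hle v hv)
  let w : ℕ → Ω → ℝ≥0∞ := partialSups v
  have hw : ∀ n, w n ∈ V := by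
    intro n
    induction n with
    | zero => simpa [w] using hv 0
    | succ n ih => simpa [w] using hsup _ ih _ (hv (n + 1))
  have hwmono : Monotone w := (partialSups v).monotone
  have hwm : ∀ n, Measurable (w n) := fun n => hmeas _ (hw n)
  let u : Ω → ℝ≥0∞ := fun ω => ⨆ n, w n ω
  have hu : Measurable u := .iSup hwm
  have hus : s ≤ ∫⁻ ω, u ω ∂μ := by
    refine le_of_tendsto' halim fun n => ?_
    rw [← hva n]
    exact lintegral_mono fun ω => (le_partialSups v n ω).trans (le_iSup (fun n => w n ω) n)
  -- Joining one more `g` cannot raise the integral above the supremum already reached by `u`, so `g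
  -- ⊔ u = u` a.e.
  have hsu : ∀ g ∈ V, ∫⁻ ω, (g ω ⊔ u ω) ∂μ ≤ s := by
    intro g hg
    have : ∀ ω, g ω ⊔ u ω = ⨆ n, (g ⊔ w n) ω := fun ω => by simp [u, sup_iSup]
    simp_rw [this]
    rw [lintegral_iSup (fun n => (hmeas g hg).sup (hwm n))
      fun a b hab => sup_le_sup_left (hwmono hab) g]
    exact iSup_le fun n => hle' _ (hsup _ hg _ (hw n))
  have hus' : ∫⁻ ω, u ω ∂μ ≤ s :=
    (lintegral_mono fun ω => le_sup_right).trans (hsu _ (hv 0))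
  refine ⟨u, hu, hus'.trans hsC, fun g hg => ?_⟩
  have := ae_eq_of_ae_le_of_lintegral_le (μ := μ) (f := u) (g := fun ω => g ω ⊔ u ω)
    (ae_of_all _ fun ω => le_sup_right) (ne_top_of_le_ne_top hC (hus'.trans hsC))
    ((hmeas g hg).sup hu).aemeasurable ((hsu g hg).trans hus)
  filter_upwards [this] with ω hω
  rw [hω]
  exact le_sup_left

end EssSup

/-! ### Intermediate values of atomless measures. -/

section Atomless

variable {Ω : Type*} [MeasurableSpace Ω]

/-- Keeping the lighter part of a splitting at least halves the measure each time. -/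
theorem IsAtomless.exists_small {m : Measure Ω} [IsFiniteMeasure m] (hm : IsAtomless m)
    {A : Set Ω} (hA : MeasurableSet A) (hA0 : m A ≠ 0) {η : ℝ≥0∞} (hη : η ≠ 0) :
    ∃ B ⊆ A, MeasurableSet B ∧ m B ≠ 0 ∧ m B ≤ η := by
  have key : ∀ n : ℕ, ∃ B ⊆ A, MeasurableSet B ∧ m B ≠ 0 ∧ m B ≤ m A * 2⁻¹ ^ n := by
    intro n
    induction n with
    | zero => exact ⟨A, Subset.rfl, hA, hA0, by simp⟩
    | succ n ih =>
      obtain ⟨B, hBA, hB, hB0, hBle⟩ := ih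
      obtain ⟨D, hDB, hD, hD0, hD1⟩ := hm B hB hB0
      have hsum : m D + m (B \ D) = m B := by
        rw [← measure_inter_add_sdiff B hD, inter_eq_self_of_subset_right hDB]
      have hhalf : m B * 2⁻¹ ≤ m A * 2⁻¹ ^ (n + 1) := by
        rw [pow_succ, ← mul_assoc]
        gcongr
      rcases le_total (m D) (m (B \ D)) with h | h
      · refine ⟨D, hDB.trans hBA, hD, hD0, le_trans ?_ hhalf⟩
        rw [← div_eq_mul_inv, ENNReal.le_div_iff_mul_le (by simp) (by simp), mul_two, ← hsum]
        gcongr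
      · refine ⟨B \ D, sdiff_subset.trans hBA, hB.diff hD, hD1, le_trans ?_ hhalf⟩
        rw [← div_eq_mul_inv, ENNReal.le_div_iff_mul_le (by simp) (by simp), mul_two, ← hsum]
        gcongr
  have hlim : Tendsto (fun n : ℕ => m A * 2⁻¹ ^ n) atTop (𝓝 0) := by
    have := ENNReal.Tendsto.const_mul (a := m A)
      (ENNReal.tendsto_pow_atTop_nhds_zero_of_lt_one (r := 2⁻¹) (by simp))
      (Or.inr (measure_ne_top m A))
    simpa using this
  obtain ⟨n, hn⟩ := (hlim.eventually (ge_mem_nhds (pos_iff_ne_zero.2 hη))).exists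
  obtain ⟨B, hBA, hB, hB0, hBle⟩ := key n
  exact ⟨B, hBA, hB, hB0, hBle.trans hn⟩

/-- Sierpiński's theorem: a finite atomless measure takes all intermediate values. -/
theorem IsAtomless.exists_subset_measure_eq {m : Measure Ω} [IsFiniteMeasure m]
    (hm : IsAtomless m) {C : Set Ω} (hC : MeasurableSet C) {c : ℝ≥0∞} (hc : c ≤ m C) :
    ∃ B ⊆ C, MeasurableSet B ∧ m B = c := by
  have hctop : c ≠ ∞ := ne_top_of_le_ne_top (measure_ne_top m C) hc
  -- Greedy choice: the added set has at least half the measure of any set that could still be added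
  -- without exceeding `c`.
  have step : ∀ B : {B : Set Ω // B ⊆ C ∧ MeasurableSet B ∧ m B ≤ c},
      ∃ D : Set Ω, D ⊆ C \ B ∧ MeasurableSet D ∧ m B + m D ≤ c ∧
        ∀ D' ⊆ C \ B, MeasurableSet D' → m B + m D' ≤ c → m D' ≤ 2 * m D := by
    rintro ⟨B, hBC, hB, hBc⟩
    let 𝓓 : Set (Set Ω) := {D | D ⊆ C \ B ∧ MeasurableSet D ∧ m B + m D ≤ c}
    let s := ⨆ D ∈ 𝓓, m D
    have hle : ∀ D ∈ 𝓓, m D ≤ s := fun D hD => le_iSup₂ (f := fun D (_ : D ∈ 𝓓) => m D) D hD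
    have hsc : s ≤ c := iSup₂_le fun D hD => le_add_self.trans hD.2.2
    by_cases hs : s = 0
    · refine ⟨∅, empty_subset _, .empty, by simpa using hBc, fun D' h1 h2 h3 => ?_⟩
      simpa [hs] using hle D' ⟨h1, h2, h3⟩
    · have hlt : s / 2 < s := ENNReal.half_lt_self hs (ne_top_of_le_ne_top hctop hsc)
      simp only [s, lt_iSup_iff] at hlt
      obtain ⟨D, h, hlt⟩ := hlt
      refine ⟨D, h.1, h.2.1, h.2.2, fun D' h1 h2 h3 => (hle D' ⟨h1, h2, h3⟩).trans ?_⟩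
      rw [mul_comm]
      exact (ENNReal.div_le_iff (by simp) (by simp)).1 hlt.le
  choose D hDsub hDm hDc hDmax using step
  let W : ℕ → {B : Set Ω // B ⊆ C ∧ MeasurableSet B ∧ m B ≤ c} := fun n =>
    Nat.rec ⟨∅, empty_subset _, .empty, by simp⟩
      (fun _ V => ⟨V.1 ∪ D V, union_subset V.2.1 ((hDsub V).trans sdiff_subset),
        V.2.2.1.union (hDm V), (measure_union_le _ _).trans (hDc V)⟩) n
  have hWsucc : ∀ n, (W (n + 1)).1 = (W n).1 ∪ D (W n) := fun n => rfl
  have hWm : ∀ n, m (W (n + 1)).1 = m (W n).1 + m (D (W n)) := fun n => by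
    rw [hWsucc, measure_union _ (hDm _)]
    exact disjoint_sdiff_right.mono_right (hDsub _)
  have hmono : Monotone fun n => (W n).1 :=
    monotone_nat_of_le_succ fun n => by rw [hWsucc]; exact subset_union_left
  have hUm : m (⋃ n, (W n).1) ≤ c := by
    rw [hmono.measure_iUnion]
    exact iSup_le fun n => (W n).2.2.2
  have hUC : ⋃ n, (W n).1 ⊆ C := iUnion_subset fun n => (W n).2.1
  have hUmeas : MeasurableSet (⋃ n, (W n).1) := .iUnion fun n => (W n).2.2.1
  refine ⟨⋃ n, (W n).1, hUC, hUmeas, ?_⟩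
  by_contra hne
  have hlt : m (⋃ n, (W n).1) < c := lt_of_le_of_ne hUm hne
  have hdiff : m (C \ ⋃ n, (W n).1) ≠ 0 := by
    rw [measure_sdiff hUC hUmeas.nullMeasurableSet (measure_ne_top _ _)]
    exact (tsub_pos_of_lt (hlt.trans_le hc)).ne'
  -- If the union fell short of `c`, this `D'` would be admissible at every stage, and each
  -- increment would be at least half its measure, which is impossible below `c`.
  obtain ⟨D', hD'sub, hD', hD'0, hD'le⟩ := hm.exists_small (hC.diff hUmeas) hdiff
    (tsub_pos_of_lt hlt).ne'
  have hbig : ∀ n, m D' ≤ 2 * m (D (W n)) := fun n => by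
    refine hDmax (W n) D' (hD'sub.trans (sdiff_subset_sdiff_right (subset_iUnion (fun n => (W n).1) n))) hD' ?_
    calc m (W n).1 + m D' ≤ m (⋃ n, (W n).1) + (c - m (⋃ n, (W n).1)) :=
          add_le_add (measure_mono (subset_iUnion (fun n => (W n).1) n)) hD'le
      _ = c := add_tsub_cancel_of_le hUm
  have hgrow : ∀ n : ℕ, (n : ℝ≥0∞) * m D' ≤ 2 * m (W n).1 := by
    intro n
    induction n with
    | zero => simp
    | succ n ih =>
      rw [hWm, mul_add, Nat.cast_succ, add_mul, one_mul]
      exact add_le_add ih (hbig n)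
  obtain ⟨n, hn⟩ := ENNReal.exists_nat_mul_gt hD'0 (b := 2 * c)
    (ENNReal.mul_ne_top (by simp) hctop)
  exact absurd (hn.trans_le (hgrow n)) (not_lt.2 (by gcongr; exact (W n).2.2.2))

/-- Null sets of the new measure are those meeting `{g ≠ 0}` in a `μ`-null set, so it suffices to
split inside `{g ≠ 0}`. -/
theorem IsAtomless.withDensity {μ : Measure Ω} (hμ : IsAtomless μ) {g : Ω → ℝ≥0∞}
    (hg : Measurable g) : IsAtomless (μ.withDensity g) := by
  intro A hA hA0
  have key : ∀ S, MeasurableSet S → (μ.withDensity g S = 0 ↔ μ ({x | g x ≠ 0} ∩ S) = 0) :=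
    fun S hS => withDensity_apply_eq_zero hg
  have hsupp : MeasurableSet {x | g x ≠ 0} := hg (measurableSet_singleton 0).compl
  obtain ⟨B, hB, hBm, hB0, hB1⟩ := hμ _ (hsupp.inter hA) (mt (key A hA).2 hA0)
  refine ⟨B, hB.trans inter_subset_right, hBm, fun h => hB0 ?_, fun h => hB1 ?_⟩
  · rw [key B hBm, inter_eq_self_of_subset_right (hB.trans inter_subset_left)] at h
    exact h
  · rw [key _ (hA.diff hBm), ← inter_sdiff_assoc] at h
    exact h

/-- Intermediate values of the integral of a nonnegative function over subsets of a given set. -/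
theorem IsAtomless.exists_subset_setLIntegral_eq {μ : Measure Ω} (hμ : IsAtomless μ)
    {g : Ω → ℝ≥0∞} (hg : Measurable g) {C : Set Ω} (hC : MeasurableSet C)
    (hfin : ∫⁻ ω in C, g ω ∂μ ≠ ∞) {c : ℝ≥0∞} (hc : c ≤ ∫⁻ ω in C, g ω ∂μ) :
    ∃ B ⊆ C, MeasurableSet B ∧ ∫⁻ ω in B, g ω ∂μ = c := by
  have hm := hμ.withDensity (hg.indicator hC)
  have hval : ∀ B ⊆ C, MeasurableSet B →
      μ.withDensity (C.indicator g) B = ∫⁻ ω in B, g ω ∂μ := fun B hBC hB => by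
    rw [withDensity_apply _ hB]
    exact setLIntegral_congr_fun hB fun ω hω => indicator_of_mem (hBC hω) g
  have : IsFiniteMeasure (μ.withDensity (C.indicator g)) :=
    isFiniteMeasure_withDensity (by rwa [lintegral_indicator hC])
  obtain ⟨B, hBC, hB, hBc⟩ := hm.exists_subset_measure_eq hC (c := c)
    (by rwa [hval C Subset.rfl hC])
  exact ⟨B, hBC, hB, by rw [← hval B hBC hB, hBc]⟩

end Atomless


/-! ### Weak convergence and the gliding hump. -/

section WeakConvergence

variable {X : Type*} [NormedAddCommGroup X] [NormedSpace ℝ X]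

theorem tendsto_toWeakSpace_iff {ι : Type*} {l : Filter ι} {u : ι → X} {x : X} :
    Tendsto (fun k => toWeakSpace ℝ X (u k)) l (𝓝 (toWeakSpace ℝ X x)) ↔
      ∀ ℓ : StrongDual ℝ X, Tendsto (fun k => ℓ (u k)) l (𝓝 (ℓ x)) := by
  refine WeakBilin.tendsto_iff_forall_eval_tendsto (B := (topDualPairing ℝ X).flip) ?_
  intro a b hab
  refine (SeparatingDual.eq_iff_forall_dual_eq (R := ℝ)).2 fun ℓ => ?_
  exact LinearMap.congr_fun hab ℓ

/-- Uniform boundedness, applied to the images in the bidual. -/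
theorem exists_norm_le_of_weak_tendsto {u : ℕ → X} {x : X}
    (h : ∀ ℓ : StrongDual ℝ X, Tendsto (fun k => ℓ (u k)) atTop (𝓝 (ℓ x))) :
    ∃ M, ∀ k, ‖u k‖ ≤ M := by
  obtain ⟨M, hM⟩ := banach_steinhaus (𝕜 := ℝ) (𝕜₂ := ℝ)
    (g := fun k => NormedSpace.inclusionInDoubleDual ℝ X (u k)) fun ℓ => by
      obtain ⟨C, hC⟩ := (h ℓ).norm.bddAbove_range
      exact ⟨C, fun k => hC (mem_range_self k)⟩
  refine ⟨M, fun k => ?_⟩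
  rw [← (NormedSpace.inclusionInDoubleDualLi ℝ (E := X)).norm_map (u k)]
  exact hM k

/-- Gliding hump: along a sequence of `L`-projections `P n` converging strongly to zero,
`‖P n (y n)‖` cannot stay away from zero if `y n` converges weakly to zero. -/
theorem false_of_weakly_null_of_le_norm_proj {P : ℕ → X →L[ℝ] X}
    (hP : ∀ n x, ‖P n x‖ + ‖x - P n x‖ ≤ ‖x‖)
    (hP0 : ∀ x, Tendsto (fun n => ‖P n x‖) atTop (𝓝 0)) {y : ℕ → X}
    (hy : ∀ ℓ : StrongDual ℝ X, Tendsto (fun n => ℓ (y n)) atTop (𝓝 0))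
    {ε : ℝ} (hε : 0 < ε) (hle : ∀ n, ε ≤ ‖P n (y n)‖) : False := by
  -- The state is an index together with a functional of norm at most one. The next functional is
  -- large on its own hump, and the next projection is tiny on all earlier vectors.
  have step : ∀ q : ℕ × {T : StrongDual ℝ X // ∀ x, |T x| ≤ ‖x‖},
      ∃ q' : ℕ × {T : StrongDual ℝ X // ∀ x, |T x| ≤ ‖x‖},
        q.1 < q'.1 ∧ (∀ i ≤ q.1, ‖P q'.1 (y i)‖ ≤ ε / 16 * 2⁻¹ ^ q.1) ∧
        7 * ε / 8 ≤ |q'.2.1 (y q'.1)| ∧ ∀ x, |q'.2.1 x - q.2.1 x| ≤ 2 * ‖P q'.1 x‖ := by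
    rintro ⟨n, T, hT⟩
    have h1 : ∀ᶠ m in atTop, ∀ i ≤ n, ‖P m (y i)‖ ≤ ε / 16 * 2⁻¹ ^ n :=
      (finite_Iic n).eventually_all.2 fun i _ =>
        (hP0 (y i)).eventually (ge_mem_nhds (by positivity))
    have h2 : ∀ᶠ m in atTop, |T (y m)| ≤ ε / 8 := by
      have := (hy T).abs
      rw [abs_zero] at this
      exact this.eventually (ge_mem_nhds (by positivity))
    obtain ⟨m, hm1, hm2, hmn⟩ := (h1.and (h2.and (eventually_gt_atTop n))).exists
    obtain ⟨s, hs1, hs⟩ := exists_dual_vector'' ℝ (P m (y m))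
    have hs' : ∀ x, |s x| ≤ ‖x‖ := fun x => by
      simpa using s.le_of_opNorm_le hs1 x
    have hsv : s (P m (y m)) = ‖P m (y m)‖ := by simpa using hs
    have key : ∀ σ : ℝ, |σ| = 1 → |(σ * s (P m (y m)) - T (P m (y m)))| ≥ ε →
        ∃ q' : ℕ × {T : StrongDual ℝ X // ∀ x, |T x| ≤ ‖x‖},
        n < q'.1 ∧ (∀ i ≤ n, ‖P q'.1 (y i)‖ ≤ ε / 16 * 2⁻¹ ^ n) ∧
        7 * ε / 8 ≤ |q'.2.1 (y q'.1)| ∧ ∀ x, |q'.2.1 x - T x| ≤ 2 * ‖P q'.1 x‖ := by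
      intro σ hσ hbig
      -- `T'` acts as `σ • s` on the `P m` part and as `T` on the rest; the `L`-projection
      -- inequality keeps it in the unit ball.
      let T' : StrongDual ℝ X := T + (σ • s - T).comp (P m)
      have hT' : ∀ x, T' x = T x + (σ * s (P m x) - T (P m x)) := fun x => by simp [T']
      refine ⟨⟨m, T', fun x => ?_⟩, hmn, hm1, ?_, fun x => ?_⟩
      · have e : T' x = T (x - P m x) + σ * s (P m x) := by rw [hT', map_sub]; ring
        rw [e]
        calc |T (x - P m x) + σ * s (P m x)| ≤ |T (x - P m x)| + |σ * s (P m x)| := abs_add_le _ _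
          _ ≤ ‖x - P m x‖ + ‖P m x‖ := by
            rw [abs_mul, hσ, one_mul]
            exact add_le_add (hT _) (hs' _)
          _ ≤ ‖x‖ := by rw [add_comm]; exact hP m x
      · have := abs_sub_abs_le_abs_sub (σ * s (P m (y m)) - T (P m (y m))) (-T (y m))
        rw [abs_neg, sub_neg_eq_add, add_comm _ (T (y m)), ← hT'] at this
        simp only
        linarith
      · simp only [hT', add_sub_cancel_left]
        calc |σ * s (P m x) - T (P m x)| ≤ |σ * s (P m x)| + |T (P m x)| := abs_sub _ _
          _ ≤ ‖P m x‖ + ‖P m x‖ := by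
            rw [abs_mul, hσ, one_mul]
            exact add_le_add (hs' _) (hT _)
          _ = 2 * ‖P m x‖ := by ring
    have hn := hle m
    -- The sign `σ` is opposite to that of `T (P m (y m))`, so the two terms do not cancel.
    rcases le_total 0 (T (P m (y m))) with h | h
    · refine key (-1) (by simp) ?_
      rw [hsv, abs_of_nonpos (by linarith)]
      linarith
    · refine key 1 (by simp) ?_
      rw [hsv, abs_of_nonneg (by linarith)]
      linarith
  choose nxt h1 h2 h3 h4 using step
  let q : ℕ → ℕ × {T : StrongDual ℝ X // ∀ x, |T x| ≤ ‖x‖} := fun k =>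
    Nat.rec (nxt ⟨0, 0, fun x => by simp⟩) (fun _ p => nxt p) k
  let N : ℕ → ℕ := fun k => (q k).1
  let T : ℕ → StrongDual ℝ X := fun k => (q k).2.1
  have hNmono : StrictMono N := strictMono_nat_of_lt_succ fun k => h1 (q k)
  have hbig : ∀ k, 7 * ε / 8 ≤ |T k (y (N k))| := fun k => by
    cases k with
    | zero => exact h3 _
    | succ k => exact h3 (q k)
  -- Geometric bounds limit later changes at `y (N k)` to `ε / 4`, leaving at least `7ε/8 - ε/4 >
  -- ε/2` in the limit.
  have htel : ∀ k j, k ≤ j →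
      |T j (y (N k)) - T k (y (N k))| ≤ ε / 4 * (2⁻¹ ^ k - 2⁻¹ ^ j) := by
    intro k j hkj
    induction j, hkj using Nat.le_induction with
    | base => simp
    | succ j hj ih =>
      have a1 : |T (j + 1) (y (N k)) - T j (y (N k))| ≤ 2 * ‖P (N (j + 1)) (y (N k))‖ :=
        h4 (q j) (y (N k))
      have a2 : ‖P (N (j + 1)) (y (N k))‖ ≤ ε / 16 * 2⁻¹ ^ N j :=
        h2 (q j) (N k) (hNmono.monotone hj)
      have a3 : (2⁻¹ : ℝ) ^ N j ≤ 2⁻¹ ^ j :=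
        pow_le_pow_of_le_one (by norm_num) (by norm_num) hNmono.le_apply
      have a4 : ε / 16 * (2⁻¹ : ℝ) ^ N j ≤ ε / 16 * 2⁻¹ ^ j := by gcongr
      have a5 := abs_sub_le (T (j + 1) (y (N k))) (T j (y (N k))) (T k (y (N k)))
      rw [pow_succ]
      nlinarith
  have hmem : ∀ k, StrongDual.toWeakDual (T k) ∈
      WeakDual.toStrongDual ⁻¹' Metric.closedBall (0 : StrongDual ℝ X) 1 := fun k => by
    rw [mem_preimage, mem_closedBall_zero_iff]
    exact ContinuousLinearMap.opNorm_le_bound _ zero_le_one fun x => by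
      simpa using (q k).2.2 x
  -- An ultrafilter limit is used because `X` need not be separable, so the dual ball need not be
  -- weak-* sequentially compact.
  obtain ⟨S, -, hS⟩ := (WeakDual.isCompact_closedBall (0 : StrongDual ℝ X) 1).ultrafilter_le_nhds
    ((hyperfilter ℕ).map fun k => StrongDual.toWeakDual (T k))
    (le_principal_iff.2 (mem_map.2 (univ_mem' hmem)))
  have hlim : ∀ x, Tendsto (fun k => T k x) (hyperfilter ℕ) (𝓝 (S x)) := fun x =>
    ((WeakDual.eval_continuous x).tendsto S).comp (show Tendsto _ _ _ from hS)
  have hS' : ∀ k, ε / 2 ≤ |S (y (N k))| := by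
    intro k
    have : |S (y (N k)) - T k (y (N k))| ≤ ε / 4 := by
      refine le_of_tendsto ((hlim (y (N k))).sub_const _).abs ?_
      have : ∀ᶠ j in (hyperfilter ℕ : Filter ℕ), k ≤ j :=
        Nat.hyperfilter_le_atTop (eventually_ge_atTop k)
      filter_upwards [this] with j hj
      refine (htel k j hj).trans ?_
      have b1 : (2⁻¹ : ℝ) ^ k ≤ 1 := pow_le_one₀ (by norm_num) (by norm_num)
      have b2 : (0 : ℝ) ≤ 2⁻¹ ^ j := by positivity
      nlinarith
    have c := abs_sub_abs_le_abs_sub (T k (y (N k))) (S (y (N k)))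
    rw [abs_sub_comm] at c
    have := hbig k
    linarith
  have hlim0 := ((hy (WeakDual.toStrongDual S)).comp hNmono.tendsto_atTop).abs
  rw [abs_zero] at hlim0
  have : ε / 2 ≤ 0 := ge_of_tendsto' hlim0 hS'
  linarith

end WeakConvergence

/-! ### Restriction operators on `L¹` and uniform integrability. -/

section RestrictL1

variable {Ω E : Type*} [MeasurableSpace Ω] {μ : Measure Ω} [NormedAddCommGroup E]

theorem enorm_Lp_one (x : Lp E 1 μ) : ‖x‖ₑ = ∫⁻ ω, ‖x ω‖ₑ ∂μ := by
  rw [Lp.enorm_def, eLpNorm_one_eq_lintegral_enorm]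

/-- The product of an element of `L¹` with the indicator of `A`. -/
noncomputable def indicatorL1 (A : Set Ω) (hA : MeasurableSet A) (x : Lp E 1 μ) : Lp E 1 μ :=
  MemLp.toLp (A.indicator x) ((Lp.memLp x).indicator hA)

theorem coeFn_indicatorL1 {A : Set Ω} (hA : MeasurableSet A) (x : Lp E 1 μ) :
    indicatorL1 A hA x =ᵐ[μ] A.indicator x :=
  MemLp.coeFn_toLp _

theorem indicatorL1_add {A : Set Ω} (hA : MeasurableSet A) (x y : Lp E 1 μ) :
    indicatorL1 A hA (x + y) = indicatorL1 A hA x + indicatorL1 A hA y := by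
  ext1
  filter_upwards [coeFn_indicatorL1 hA (x + y), coeFn_indicatorL1 hA x, coeFn_indicatorL1 hA y,
    Lp.coeFn_add x y, Lp.coeFn_add (indicatorL1 A hA x) (indicatorL1 A hA y)]
    with ω h1 h2 h3 h4 h5
  rw [h1, h5, Pi.add_apply, h2, h3]
  by_cases h : ω ∈ A
  · simp only [h, indicator_of_mem, h4, Pi.add_apply]
  · simp [h]

theorem indicatorL1_smul [NormedSpace ℝ E] {A : Set Ω} (hA : MeasurableSet A) (c : ℝ) (x : Lp E 1 μ) :
    indicatorL1 A hA (c • x) = c • indicatorL1 A hA x := by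
  ext1
  filter_upwards [coeFn_indicatorL1 hA (c • x), coeFn_indicatorL1 hA x, Lp.coeFn_smul c x,
    Lp.coeFn_smul c (indicatorL1 A hA x)] with ω h1 h2 h3 h4
  rw [h1, h4, Pi.smul_apply, h2]
  by_cases h : ω ∈ A <;> simp [h, h3]

theorem norm_indicatorL1_le {A : Set Ω} (hA : MeasurableSet A) (x : Lp E 1 μ) :
    ‖indicatorL1 A hA x‖ ≤ ‖x‖ := by
  refine Lp.norm_le_norm_of_ae_le ?_
  filter_upwards [coeFn_indicatorL1 hA x] with ω h
  rw [h]
  exact norm_indicator_le_norm_self _ _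

variable [NormedSpace ℝ E]

/-- Multiplication by the indicator of `A`, as an operator on `L¹`. -/
noncomputable def restrictL1 (A : Set Ω) (hA : MeasurableSet A) : Lp E 1 μ →L[ℝ] Lp E 1 μ :=
  LinearMap.mkContinuous
    { toFun := indicatorL1 A hA
      map_add' := indicatorL1_add hA
      map_smul' := indicatorL1_smul hA }
    1 fun x => (norm_indicatorL1_le hA x).trans_eq (one_mul _).symm

theorem coeFn_restrictL1 {A : Set Ω} (hA : MeasurableSet A) (x : Lp E 1 μ) :
    restrictL1 A hA x =ᵐ[μ] A.indicator x :=
  coeFn_indicatorL1 hA x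

theorem enorm_restrictL1 {A : Set Ω} (hA : MeasurableSet A) (x : Lp E 1 μ) :
    ‖restrictL1 A hA x‖ₑ = ∫⁻ ω in A, ‖x ω‖ₑ ∂μ := by
  rw [enorm_Lp_one, ← lintegral_indicator hA]
  refine lintegral_congr_ae ?_
  filter_upwards [coeFn_restrictL1 hA x] with ω h
  rw [h, enorm_indicator_eq_indicator_enorm]

/-- This makes restrictions `L`-projections, as the gliding hump requires. -/
theorem norm_restrictL1_add {A : Set Ω} (hA : MeasurableSet A) (x : Lp E 1 μ) :
    ‖restrictL1 A hA x‖ + ‖x - restrictL1 A hA x‖ = ‖x‖ := by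
  have h1 : x - restrictL1 A hA x = restrictL1 Aᶜ hA.compl x := by
    ext1
    filter_upwards [coeFn_restrictL1 hA x, coeFn_restrictL1 hA.compl x,
      Lp.coeFn_sub x (restrictL1 A hA x)] with ω a b c
    rw [c, b, Pi.sub_apply, a]
    by_cases h : ω ∈ A <;> simp [h]
  have h2 : ‖restrictL1 A hA x‖ₑ + ‖restrictL1 Aᶜ hA.compl x‖ₑ = ‖x‖ₑ := by
    rw [enorm_restrictL1, enorm_restrictL1, enorm_Lp_one, lintegral_add_compl _ hA]
  have h3 := congrArg ENNReal.toReal h2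
  rwa [ENNReal.toReal_add enorm_ne_top enorm_ne_top, toReal_enorm, toReal_enorm, toReal_enorm,
    ← h1] at h3

/-- The function `‖v‖ / g` is integrable for the weighted measure, so absolute continuity of its
integral applies even when `μ` is infinite. -/
theorem tendsto_norm_restrictL1 {g : Ω → ℝ≥0∞} (hg : Measurable g) (hg0 : ∀ ω, g ω ≠ 0)
    (hgt : ∀ ω, g ω ≠ ∞) {A : ℕ → Set Ω} (hA : ∀ k, MeasurableSet (A k))
    (hlim : Tendsto (fun k => μ.withDensity g (A k)) atTop (𝓝 0)) (v : Lp E 1 μ) :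
    Tendsto (fun k => ‖restrictL1 (A k) (hA k) v‖) atTop (𝓝 0) := by
  have hvm : Measurable fun ω => ‖v ω‖ₑ := (Lp.stronglyMeasurable v).enorm
  have hdens : ∀ T, MeasurableSet T →
      ∫⁻ ω in T, (‖v ω‖ₑ / g ω) ∂(μ.withDensity g) = ∫⁻ ω in T, ‖v ω‖ₑ ∂μ := fun T hT => by
    have := setLIntegral_withDensity_eq_setLIntegral_mul μ hg (hvm.div hg) hT
    simp only [Pi.div_apply] at this
    rw [this]
    refine lintegral_congr fun ω => ?_
    exact ENNReal.mul_div_cancel (hg0 ω) (hgt ω)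
  have hfin : ∫⁻ ω, (‖v ω‖ₑ / g ω) ∂(μ.withDensity g) ≠ ∞ := by
    rw [← setLIntegral_univ, hdens _ .univ, setLIntegral_univ, ← enorm_Lp_one]
    exact enorm_ne_top
  have h := tendsto_setLIntegral_zero hfin hlim
  have h2 := (ENNReal.tendsto_toReal ENNReal.zero_ne_top).comp h
  refine h2.congr fun k => ?_
  rw [Function.comp_apply, hdens _ (hA _), ← enorm_restrictL1 (hA _), toReal_enorm]

/-- The sets where the elements of a sequentially relatively weakly compact subset of `L¹` are
large with respect to an integrable weight carry uniformly little mass. -/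
theorem exists_setLIntegral_enorm_le_of_mem_weakHadamardBornology {α : Ω → ℝ}
    (hα : Measurable α) (hpos : ∀ ω, 0 < α ω) {S : Set (Lp E 1 μ)}
    (hS : S ∈ weakHadamardBornology (Lp E 1 μ)) {ε : ℝ} (hε : 0 < ε) :
    ∃ c : ℕ, ∀ x ∈ S, ∫⁻ ω in {ω | c * α ω < ‖x ω‖}, ‖x ω‖ₑ ∂μ ≤ ENNReal.ofReal ε := by
  by_contra! hcon
  choose x hxS hx using hcon
  obtain ⟨z, s, hs, hlim⟩ := hS x hxS
  rw [tendsto_toWeakSpace_iff] at hlim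
  obtain ⟨M, hM⟩ := exists_norm_le_of_weak_tendsto hlim
  let A : ℕ → Set Ω := fun k => {ω | (s k : ℝ) * α ω < ‖x (s k) ω‖}
  have hA : ∀ k, MeasurableSet (A k) := fun k =>
    measurableSet_lt (hα.const_mul _) (Lp.stronglyMeasurable _).norm.measurable
  have hxn : ∀ k, ENNReal.ofReal ε ≤ ∫⁻ ω in A k, ‖x (s k) ω‖ₑ ∂μ := fun k => (hx (s k)).le
  let g : Ω → ℝ≥0∞ := fun ω => ENNReal.ofReal (α ω)
  have hg : Measurable g := hα.ennreal_ofReal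
  let ν := μ.withDensity g
  -- Chebyshev's inequality for the weighted measure: `s k * ν (A k) ≤ ‖x (s k)‖ ≤ M`.
  have hνA : Tendsto (ν ∘ A) atTop (𝓝 0) := by
    have hb : ∀ k, (s k : ℝ≥0∞) * ν (A k) ≤ ENNReal.ofReal M := by
      intro k
      rw [withDensity_apply _ (hA k), ← lintegral_const_mul _ hg]
      calc ∫⁻ ω in A k, (s k : ℝ≥0∞) * g ω ∂μ ≤ ∫⁻ ω in A k, ‖x (s k) ω‖ₑ ∂μ := by
            refine setLIntegral_mono' (hA k) fun ω hω => ?_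
            rw [← ofReal_norm, ← ENNReal.ofReal_natCast,
              ← ENNReal.ofReal_mul (Nat.cast_nonneg _)]
            exact ENNReal.ofReal_le_ofReal (le_of_lt hω)
        _ ≤ ‖x (s k)‖ₑ := by
            rw [enorm_Lp_one]; exact setLIntegral_le_lintegral _ _
        _ ≤ ENNReal.ofReal M := by
            rw [← ofReal_norm]; exact ENNReal.ofReal_le_ofReal (hM k)
    have hdiv : Tendsto (fun k => ENNReal.ofReal M / (s k : ℝ≥0∞)) atTop (𝓝 0) :=
      ENNReal.Tendsto.const_div (ENNReal.tendsto_nat_nhds_top.comp hs.tendsto_atTop)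
        (Or.inr ENNReal.ofReal_ne_top) |>.trans (by simp)
    refine tendsto_of_tendsto_of_tendsto_of_le_of_le' tendsto_const_nhds hdiv
      (Eventually.of_forall fun _ => zero_le) ?_
    filter_upwards [eventually_gt_atTop 0] with k hk
    have hk0 : (s k : ℝ≥0∞) ≠ 0 := by
      have := hs.le_apply (x := k)
      simp only [ne_eq, Nat.cast_eq_zero]; omega
    rw [Function.comp_apply, ENNReal.le_div_iff_mul_le (Or.inl hk0) (Or.inl (by simp)), mul_comm]
    exact hb k
  have hPz : ∀ v : Lp E 1 μ, Tendsto (fun k => ‖restrictL1 (A k) (hA k) v‖) atTop (𝓝 0) := by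
    intro v
    exact tendsto_norm_restrictL1 hg (fun ω => by simp [g, hpos ω]) (fun ω => ENNReal.ofReal_ne_top) hA hνA v
  have hPz' := hPz z
  -- Past `K` the weak limit has at most `ε / 2` on `A k`, so subtracting it leaves humps of size at
  -- least `ε / 2`.
  obtain ⟨K, hK⟩ := eventually_atTop.1 (hPz'.eventually (ge_mem_nhds (half_pos hε)))
  let P : ℕ → Lp E 1 μ →L[ℝ] Lp E 1 μ := fun k => restrictL1 (A (k + K)) (hA (k + K))
  let y : ℕ → Lp E 1 μ := fun k => x (s (k + K)) - z
  have hP : ∀ n v, ‖P n v‖ + ‖v - P n v‖ ≤ ‖v‖ := fun n v => (norm_restrictL1_add (hA _) v).le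
  have hP0 : ∀ v, Tendsto (fun n => ‖P n v‖) atTop (𝓝 0) := fun v =>
    (hPz v).comp (tendsto_add_atTop_nat K)
  have hy : ∀ ℓ : StrongDual ℝ (Lp E 1 μ), Tendsto (fun n => ℓ (y n)) atTop (𝓝 0) := fun ℓ => by
    have := ((hlim ℓ).comp (tendsto_add_atTop_nat K)).sub_const (ℓ z)
    rw [sub_self] at this
    exact this.congr fun n => (map_sub ℓ _ _).symm
  have hPy : ∀ n, ε / 2 ≤ ‖P n (y n)‖ := fun n => by
    have h1 : ε ≤ ‖P n (x (s (n + K)))‖ := by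
      have := hxn (n + K)
      rw [← enorm_restrictL1 (hA _), ← ofReal_norm] at this
      exact (ENNReal.ofReal_le_ofReal_iff (norm_nonneg _)).1 this
    have h2 : ‖P n z‖ ≤ ε / 2 := hK (n + K) (by omega)
    have h3 : P n (y n) = P n (x (s (n + K))) - P n z := map_sub _ _ _
    rw [h3]
    have := norm_sub_norm_le (P n (x (s (n + K)))) (P n z)
    linarith
  exact false_of_weakly_null_of_le_norm_proj hP hP0 hy (half_pos hε) hPy

end RestrictL1


/-! ### Young functions and the de la Vallée-Poussin criterion. -/

/-- Young functions: nondecreasing convex superlinear functions `ψ : [0, ∞) → [0, ∞)` vanishing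
at the origin. -/
structure IsYoungFunction (ψ : ℝ → ℝ) : Prop where
  nonneg : ∀ t, 0 ≤ t → 0 ≤ ψ t
  map_zero : ψ 0 = 0
  monotoneOn : MonotoneOn ψ (Ici 0)
  convexOn : ConvexOn ℝ (Ici 0) ψ
  superlinear : Tendsto (fun t => ψ t / t) atTop atTop

namespace IsYoungFunction

variable {ψ : ℝ → ℝ}

theorem measurable_comp_max (hψ : IsYoungFunction ψ) : Measurable fun t => ψ (max t 0) :=
  Monotone.measurable fun _ _ h =>
    hψ.monotoneOn (mem_Ici.2 (le_max_right _ _)) (mem_Ici.2 (le_max_right _ _))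
      (max_le_max h le_rfl)

theorem measurable_comp (hψ : IsYoungFunction ψ) {Ω : Type*} [MeasurableSpace Ω] {g : Ω → ℝ}
    (hg : Measurable g) (h0 : ∀ ω, 0 ≤ g ω) : Measurable fun ω => ψ (g ω) := by
  have := hψ.measurable_comp_max.comp hg
  have e : (fun ω => ψ (g ω)) = (fun t => ψ (max t 0)) ∘ g := funext fun ω => by simp [h0 ω]
  rwa [e]

end IsYoungFunction

/-- The Young function `t ↦ ∑ (t - c n)⁺`. -/
theorem isYoungFunction_tsum {c : ℕ → ℝ} (hc : ∀ n : ℕ, (n : ℝ) ≤ c n) :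
    IsYoungFunction fun t => ∑' n, max (t - c n) 0 := by
  -- Since `c n ≥ n`, only finitely many terms are nonzero on bounded sets.
  have hsum : ∀ (t : ℝ) (N : ℕ), t ≤ N →
      ∑' n, max (t - c n) 0 = ∑ n ∈ Finset.range N, max (t - c n) 0 := fun t N htN =>
    tsum_eq_sum fun n hn => by
      have h1 : (N : ℝ) ≤ n := by exact_mod_cast not_lt.1 (mt Finset.mem_range.2 hn)
      exact max_eq_right (by linarith [hc n])
  refine ⟨fun t _ => tsum_nonneg fun n => le_max_right _ _, ?_, ?_, ⟨convex_Ici 0, ?_⟩, ?_⟩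
  · rw [hsum 0 0 (by simp)]; simp
  · intro s _ t _ hst
    obtain ⟨N, hN⟩ := exists_nat_ge t
    simp only
    rw [hsum s N (hst.trans hN), hsum t N hN]
    exact Finset.sum_le_sum fun n _ => max_le_max (by linarith) le_rfl
  · intro s _ t _ a b ha hb hab
    obtain ⟨N, hN⟩ := exists_nat_ge (max s t)
    have hs := (le_max_left s t).trans hN
    have ht := (le_max_right s t).trans hN
    have hst : a • s + b • t ≤ N := by
      simp only [smul_eq_mul]
      calc a * s + b * t ≤ a * N + b * N := by gcongr
        _ = N := by rw [← add_mul, hab, one_mul]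
    simp only
    rw [hsum _ N hst, hsum s N hs, hsum t N ht, Finset.smul_sum, Finset.smul_sum,
      ← Finset.sum_add_distrib]
    refine Finset.sum_le_sum fun n _ => max_le ?_ ?_
    · have h1 := mul_le_mul_of_nonneg_left (le_max_left (s - c n) 0) ha
      have h2 := mul_le_mul_of_nonneg_left (le_max_left (t - c n) 0) hb
      have h3 : c n = a * c n + b * c n := by rw [← add_mul, hab, one_mul]
      simp only [smul_eq_mul]
      linarith
    · exact add_nonneg (mul_nonneg ha (le_max_right _ _)) (mul_nonneg hb (le_max_right _ _))
  · refine tendsto_atTop.2 fun B => ?_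
    -- Once `t` exceeds `2 * c n` for `n < N`, each of these terms is at least `t / 2`, and together
    -- they give `B * t`.
    obtain ⟨N, hN⟩ := exists_nat_ge (2 * B)
    have h1 : ∀ᶠ t : ℝ in atTop, ∀ n ∈ Finset.range N, 2 * c n ≤ t :=
      (Finset.range N).eventually_all.2 fun n _ => eventually_ge_atTop _
    filter_upwards [h1, eventually_gt_atTop 0] with t ht ht0
    obtain ⟨K, hK⟩ := exists_nat_ge (max t N)
    have hNK : N ≤ K := by exact_mod_cast (le_max_right t (N : ℝ)).trans hK
    rw [hsum t K ((le_max_left _ _).trans hK), le_div_iff₀ ht0]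
    calc B * t ≤ ∑ n ∈ Finset.range N, t / 2 := by
          rw [Finset.sum_const, Finset.card_range, nsmul_eq_mul]; nlinarith
      _ ≤ ∑ n ∈ Finset.range N, max (t - c n) 0 :=
          Finset.sum_le_sum fun n hn => le_max_of_le_left (by linarith [ht n hn])
      _ ≤ ∑ n ∈ Finset.range K, max (t - c n) 0 :=
          Finset.sum_le_sum_of_subset_of_nonneg (Finset.range_mono hNK)
            fun n _ _ => le_max_right _ _

section

variable {Ω E : Type*} [MeasurableSpace Ω] {μ : Measure Ω} [NormedAddCommGroup E]
  [NormedSpace ℝ E]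

/-- De la Vallée-Poussin criterion on sequentially relatively weakly compact subsets of `L¹`. -/
theorem exists_isYoungFunction_of_mem_weakHadamardBornology {α : Ω → ℝ}
    (hα : Measurable α) (hpos : ∀ ω, 0 < α ω) {S : Set (Lp E 1 μ)}
    (hS : S ∈ weakHadamardBornology (Lp E 1 μ)) :
    ∃ ψ, IsYoungFunction ψ ∧
      ∀ x ∈ S, ∫⁻ ω, ENNReal.ofReal (α ω * ψ ((α ω)⁻¹ * ‖x ω‖)) ∂μ ≤ 2 := by
  have h : ∀ n : ℕ, ∃ c : ℕ, ∀ x ∈ S,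
      ∫⁻ ω in {ω | c * α ω < ‖x ω‖}, ‖x ω‖ₑ ∂μ ≤ ENNReal.ofReal (2⁻¹ ^ n) := fun n =>
    exists_setLIntegral_enorm_le_of_mem_weakHadamardBornology hα hpos hS (by positivity)
  choose c hc using h
  -- Enlarging the thresholds to `d n ≥ n` makes the series locally finite and only decreases its
  -- terms; the integrals then sum to at most `∑ 2⁻ⁿ = 2`.
  let d : ℕ → ℝ := fun n => max (c n) n
  have hd : ∀ n : ℕ, (n : ℝ) ≤ d n := fun n => le_max_right _ _
  refine ⟨_, isYoungFunction_tsum hd, fun x hx => ?_⟩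
  have hxm : Measurable fun ω => ‖x ω‖ := (Lp.stronglyMeasurable x).norm.measurable
  have hsumm : ∀ t : ℝ, Summable fun n => max (t - d n) 0 := fun t => by
    obtain ⟨N, hN⟩ := exists_nat_ge t
    refine summable_of_ne_finset_zero (s := Finset.range N) fun n hn => ?_
    have h1 : (N : ℝ) ≤ n := by exact_mod_cast not_lt.1 (mt Finset.mem_range.2 hn)
    exact max_eq_right (by linarith [hd n])
  have hmeas : ∀ n, Measurable fun ω =>
      ENNReal.ofReal (α ω * max ((α ω)⁻¹ * ‖x ω‖ - d n) 0) := fun n =>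
    (hα.mul (((hα.inv.mul hxm).sub_const _).max measurable_const)).ennreal_ofReal
  calc ∫⁻ ω, ENNReal.ofReal (α ω * ∑' n, max ((α ω)⁻¹ * ‖x ω‖ - d n) 0) ∂μ
      = ∫⁻ ω, ∑' n, ENNReal.ofReal (α ω * max ((α ω)⁻¹ * ‖x ω‖ - d n) 0) ∂μ := by
        refine lintegral_congr fun ω => ?_
        rw [← tsum_mul_left, ENNReal.ofReal_tsum_of_nonneg
          (fun n => mul_nonneg (hpos ω).le (le_max_right _ _)) ((hsumm _).mul_left _)]
    _ = ∑' n, ∫⁻ ω, ENNReal.ofReal (α ω * max ((α ω)⁻¹ * ‖x ω‖ - d n) 0) ∂μ :=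
        lintegral_tsum fun n => (hmeas n).aemeasurable
    _ ≤ ∑' n : ℕ, ENNReal.ofReal (2⁻¹ ^ n) := by
        refine ENNReal.tsum_le_tsum fun n => le_trans ?_ (hc n x hx)
        rw [← lintegral_indicator (measurableSet_lt (hα.const_mul _) hxm)]
        refine lintegral_mono fun ω => ?_
        have hα0 := hpos ω
        by_cases hω : (c n : ℝ) * α ω < ‖x ω‖
        · rw [indicator_of_mem (by exact hω), ← ofReal_norm]
          refine ENNReal.ofReal_le_ofReal ?_
          have hd0 : 0 ≤ d n := (Nat.cast_nonneg n).trans (hd n)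
          have : max ((α ω)⁻¹ * ‖x ω‖ - d n) 0 ≤ (α ω)⁻¹ * ‖x ω‖ :=
            max_le (by linarith) (by positivity)
          calc α ω * max ((α ω)⁻¹ * ‖x ω‖ - d n) 0 ≤ α ω * ((α ω)⁻¹ * ‖x ω‖) := by gcongr
            _ = ‖x ω‖ := mul_inv_cancel_left₀ hα0.ne' _
        · rw [indicator_of_notMem (by exact hω)]
          have h1 : (α ω)⁻¹ * ‖x ω‖ ≤ c n := by
            rw [inv_mul_le_iff₀ hα0, mul_comm]; exact not_lt.1 hω
          have h2 : (c n : ℝ) ≤ d n := le_max_left _ _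
          rw [max_eq_right (by linarith), mul_zero, ENNReal.ofReal_zero]
    _ = 2 := by
        simp_rw [ENNReal.ofReal_pow (show (0 : ℝ) ≤ 2⁻¹ by norm_num)]
        rw [ENNReal.tsum_geometric, ENNReal.ofReal_inv_of_pos (by norm_num)]
        simp

end


/-! ### Extended real arithmetic of difference quotients. -/

section EReal

theorem le_coe_sub_of_ofReal_le_toENNReal {v : EReal} {u g : ℝ} (hvu : v ≤ (u : EReal))
    (h : ENNReal.ofReal g ≤ ((u : EReal) - v).toENNReal) : v ≤ ((u - g : ℝ) : EReal) := by
  induction v with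
  | bot => exact bot_le
  | top => simp at hvu
  | coe v =>
    rw [← EReal.coe_sub, EReal.real_coe_toENNReal] at h
    have h1 : v ≤ u := EReal.coe_le_coe_iff.1 hvu
    have := (ENNReal.ofReal_le_ofReal_iff (by linarith)).1 h
    exact EReal.coe_le_coe_iff.2 (by linarith)

theorem eq_coe_sub_toReal_toENNReal {v : EReal} {u : ℝ} (hvu : v ≤ (u : EReal))
    (h : ((u : EReal) - v).toENNReal ≠ ∞) :
    v = ((u - ((u : EReal) - v).toENNReal.toReal : ℝ) : EReal) := by
  induction v with
  | bot => simp at h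
  | top => simp at hvu
  | coe v =>
    have h1 : v ≤ u := EReal.coe_le_coe_iff.1 hvu
    rw [← EReal.coe_sub, EReal.real_coe_toENNReal, ENNReal.toReal_ofReal (by linarith)]
    norm_num

/-- This removes subtraction from the inequality while allowing `G` to be infinite; it serves both
the integrand and the integral functional. -/
theorem coe_le_quotient_sub_iff {G : EReal} {r w l K : ℝ} (hr : 0 < r) :
    (K : EReal) ≤ ((r⁻¹ : ℝ) : EReal) * (G - (w : EReal)) - (l : EReal) ↔
      ((w + r * (l + K) : ℝ) : EReal) ≤ G := by
  induction G with
  | bot =>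
    rw [EReal.bot_sub, EReal.coe_mul_bot_of_pos (inv_pos.2 hr), EReal.bot_sub, le_bot_iff,
      le_bot_iff]
    exact iff_of_false (EReal.coe_ne_bot _) (EReal.coe_ne_bot _)
  | top => simp [EReal.coe_mul_top_of_pos (inv_pos.2 hr)]
  | coe G =>
    norm_cast
    rw [le_sub_iff_add_le, ← div_eq_inv_mul, le_div_iff₀ hr]
    constructor <;> intro h <;> linarith

/-- Finiteness at the base point lets the linear term leave the quotient even where `g` is infinite.
-/
theorem diffQuot_sub_clm {E : Type*} [NormedAddCommGroup E] [NormedSpace ℝ E] {g : E → EReal}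
    {a : E} {w : ℝ} (hw : g a = (w : EReal)) (ℓ : StrongDual ℝ E) (e : E) {r : ℝ} (hr : 0 < r) :
    diffQuot (fun e' => g e' - ((ℓ e' : ℝ) : EReal)) a e r =
      ((r⁻¹ : ℝ) : EReal) * (g (a + r • e) - (w : EReal)) - ((ℓ e : ℝ) : EReal) := by
  simp only [diffQuot, hw, map_add, map_smul, smul_eq_mul]
  induction g (a + r • e) with
  | bot => simp [EReal.coe_mul_bot_of_pos (inv_pos.2 hr)]
  | top =>
    rw [EReal.top_sub_coe, EReal.top_sub_coe, ← EReal.coe_sub, EReal.top_sub_coe,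
      EReal.coe_mul_top_of_pos (inv_pos.2 hr), EReal.top_sub_coe]
  | coe G =>
    norm_cast
    field_simp
    ring

end EReal

/-! ### Upper integrals. -/

section UpperIntegral

variable {Ω : Type*} [MeasurableSpace Ω] {μ : Measure Ω}

theorem upperIntegral_le {v : Ω → EReal} {u : Ω → ℝ} (hu : Integrable u μ)
    (h : ∀ᵐ ω ∂μ, v ω ≤ ((u ω : ℝ) : EReal)) : upperIntegral μ v ≤ ((∫ ω, u ω ∂μ : ℝ) : EReal) :=
  (iInf_le _ u).trans ((iInf_le _ hu).trans (iInf_le _ h))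

theorem le_upperIntegral {v : Ω → EReal} {c : EReal}
    (h : ∀ u : Ω → ℝ, Integrable u μ → (∀ᵐ ω ∂μ, v ω ≤ ((u ω : ℝ) : EReal)) →
      c ≤ ((∫ ω, u ω ∂μ : ℝ) : EReal)) : c ≤ upperIntegral μ v :=
  le_iInf fun u => le_iInf fun hu => le_iInf fun hv => h u hu hv

/-- A measurable function with finite upper integral is integrable. -/
theorem exists_integrable_of_upperIntegral_finite [SigmaFinite μ] [μ.IsComplete] {v : Ω → EReal}
    (hv : Measurable v) (htop : upperIntegral μ v ≠ ⊤) (hbot : upperIntegral μ v ≠ ⊥) :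
    ∃ w : Ω → ℝ, Measurable w ∧ Integrable w μ ∧ (∀ᵐ ω ∂μ, v ω = ((w ω : ℝ) : EReal)) ∧
      upperIntegral μ v = ((∫ ω, w ω ∂μ : ℝ) : EReal) := by
  obtain ⟨u, hu, huv⟩ : ∃ u : Ω → ℝ, Integrable u μ ∧ ∀ᵐ ω ∂μ, v ω ≤ ((u ω : ℝ) : EReal) := by
    by_contra! hcon
    refine htop (top_le_iff.1 (le_upperIntegral fun u hu huv => ?_))
    exact absurd huv (by simpa using hcon u hu)
  have hum : Measurable u := aemeasurable_iff_measurable.1 hu.aemeasurable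
  let h : Ω → ℝ≥0∞ := fun ω => (((u ω : ℝ) : EReal) - v ω).toENNReal
  have hh : Measurable h := by
    have h1 : Measurable fun ω => ((u ω : ℝ) : EReal) - v ω :=
      (measurable_coe_real_ereal.comp hum).sub hv
    exact measurable_ereal_toENNReal.comp h1
  -- If the gap `h` had infinite integral, subtracting integrable simple functions below `h` from
  -- `u` would give majorants of `v` with arbitrarily negative integrals. Sigma-finiteness supplies
  -- these functions.
  have hfin : ∫⁻ ω, h ω ∂μ ≠ ∞ := by
    intro hinf
    refine hbot (le_bot_iff.1 (EReal.le_of_forall_lt_iff_le.1 fun z _ => ?_))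
    have hlt : ENNReal.ofReal (∫ ω, u ω ∂μ - z) < ∫⁻ ω, h ω ∂μ := by
      rw [hinf]; exact ENNReal.ofReal_lt_top
    rw [lintegral_eq_nnreal] at hlt
    simp only [lt_iSup_iff] at hlt
    obtain ⟨g₀, hg₀, hlt⟩ := hlt
    rw [← SimpleFunc.lintegral_eq_lintegral, SimpleFunc.coe_map] at hlt
    obtain ⟨g, hg, hgfin, hlt⟩ := SimpleFunc.exists_lt_lintegral_simpleFunc_of_lt_lintegral
      (f := g₀) (by simpa using hlt)
    have hgi : Integrable (fun ω => (g ω : ℝ)) μ := by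
      refine ⟨g.measurable.coe_nnreal_real.aestronglyMeasurable, ?_⟩
      simpa only [hasFiniteIntegral_iff_enorm, NNReal.enorm_eq] using hgfin
    rw [lintegral_coe_eq_integral _ hgi] at hlt
    have hlt' : ∫ ω, u ω ∂μ - z < ∫ ω, (g ω : ℝ) ∂μ := by
      by_contra! hle
      exact absurd hlt (not_lt.2 (ENNReal.ofReal_le_ofReal hle))
    refine (upperIntegral_le (hu.sub hgi) ?_).trans ?_
    · filter_upwards [huv] with ω hω
      have h1 : ((g ω : ℝ≥0∞)) ≤ h ω := le_trans (by exact_mod_cast hg ω) (hg₀ ω)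
      exact le_coe_sub_of_ofReal_le_toENNReal hω (by simpa using h1)
    · rw [integral_sub' hu hgi]
      exact EReal.coe_le_coe_iff.2 (by linarith)
  let w : Ω → ℝ := fun ω => u ω - (h ω).toReal
  have hw : Measurable w := hum.sub hh.ennreal_toReal
  have hwi : Integrable w μ := hu.sub (integrable_toReal_of_lintegral_ne_top hh.aemeasurable hfin)
  have hvw : ∀ᵐ ω ∂μ, v ω = ((w ω : ℝ) : EReal) := by
    filter_upwards [huv, ae_lt_top hh hfin] with ω h1 h2
    exact eq_coe_sub_toReal_toENNReal h1 h2.ne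
  refine ⟨w, hw, hwi, hvw, le_antisymm (upperIntegral_le hwi ?_) (le_upperIntegral ?_)⟩
  · filter_upwards [hvw] with ω h using h.le
  · intro u' hu' hvu'
    refine EReal.coe_le_coe_iff.2 (integral_mono_ae hwi hu' ?_)
    filter_upwards [hvw, hvu'] with ω h1 h2
    rw [h1] at h2
    exact EReal.coe_le_coe_iff.1 h2

end UpperIntegral

/-! ### The pairing of `L¹` with bounded scalarly measurable maps. -/

section Pairing

variable {Ω F : Type*} [MeasurableSpace Ω] {μ : Measure Ω} [NormedAddCommGroup F]
  [NormedSpace ℝ F] {y : Ω → StrongDual ℝ F}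

theorem measurable_pairing (hy : ∀ e, Measurable fun ω => y ω e) {x : Ω → F}
    (hx : StronglyMeasurable x) : Measurable fun ω => y ω (x ω) := by
  refine measurable_of_tendsto_metrizable (f := fun n ω => y ω (hx.approx n ω))
    (fun n => (hx.approx n).measurable_bind (fun e ω => y ω e) hy) ?_
  rw [tendsto_pi_nhds]
  exact fun ω => ((y ω).continuous.tendsto _).comp (hx.tendsto_approx ω)

theorem integrable_pairing (hy : ∀ e, Measurable fun ω => y ω e) {M : ℝ}
    (hM : ∀ᵐ ω ∂μ, ‖y ω‖ ≤ M) (x : Lp F 1 μ) : Integrable (fun ω => y ω (x ω)) μ := by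
  refine ((L1.integrable_coeFn x).norm.const_mul M).mono'
    (measurable_pairing hy (Lp.stronglyMeasurable x)).aestronglyMeasurable ?_
  filter_upwards [hM] with ω hω
  exact (y ω).le_of_opNorm_le hω _

/-- An essentially bounded scalarly measurable map defines a functional on `L¹`. -/
theorem exists_strongDual_pairing (hy : ∀ e, Measurable fun ω => y ω e) {M : ℝ}
    (hM : ∀ᵐ ω ∂μ, ‖y ω‖ ≤ M) :
    ∃ ℓ : StrongDual ℝ (Lp F 1 μ), ∀ x : Lp F 1 μ, ℓ x = ∫ ω, y ω (x ω) ∂μ := by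
  refine ⟨LinearMap.mkContinuous
    { toFun := fun x => ∫ ω, y ω (x ω) ∂μ
      map_add' := fun x z => ?_
      map_smul' := fun c x => ?_ } M fun x => ?_, fun x => rfl⟩
  · rw [← integral_add (integrable_pairing hy hM x) (integrable_pairing hy hM z)]
    refine integral_congr_ae ?_
    filter_upwards [Lp.coeFn_add x z] with ω h
    rw [h, Pi.add_apply, map_add]
  · rw [RingHom.id_apply, smul_eq_mul, ← integral_const_mul]
    refine integral_congr_ae ?_
    filter_upwards [Lp.coeFn_smul c x] with ω h
    rw [h, Pi.smul_apply, map_smul, smul_eq_mul]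
  · simp only [LinearMap.coe_mk, AddHom.coe_mk]
    rw [L1.norm_eq_integral_norm, ← integral_const_mul]
    refine norm_integral_le_of_norm_le ((L1.integrable_coeFn x).norm.const_mul M) ?_
    filter_upwards [hM] with ω hω
    exact (y ω).le_of_opNorm_le hω _

theorem MemLinftyWeakStar.exists_ae_norm_le (hy : MemLinftyWeakStar μ y) :
    ∃ M, ∀ᵐ ω ∂μ, ‖y ω‖ ≤ M := by
  refine ⟨(eLpNormEssSup (fun ω => ‖y ω‖) μ).toReal, ?_⟩
  have hlt : eLpNormEssSup (fun ω => ‖y ω‖) μ < ∞ := by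
    have := hy.2.2
    rwa [eLpNorm_exponent_top] at this
  filter_upwards [enorm_ae_le_eLpNormEssSup (fun ω => ‖y ω‖) μ] with ω h
  have := ENNReal.toReal_mono hlt.ne h
  simpa using this

end Pairing

/-! ### From the growth condition to the subderivative. -/

section Sufficiency

variable {Ω E : Type*} [MeasurableSpace Ω] {μ : Measure Ω} [NormedAddCommGroup E]
  [NormedSpace ℝ E]

theorem zero_le_liminf_of_forall_eventually {F : ℝ → EReal} {l : Filter ℝ}
    (h : ∀ δ : ℝ, 0 < δ → ∀ᶠ r in l, ((-δ : ℝ) : EReal) ≤ F r) : (0 : EReal) ≤ liminf F l := by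
  refine le_of_forall_lt fun c hc => ?_
  obtain ⟨z, hcz, hz⟩ := EReal.lt_iff_exists_real_btwn.1 hc
  refine hcz.trans_le (le_liminf_of_le (by isBoundedDefault) ?_)
  simpa using h (-z) (by simpa using EReal.coe_lt_coe_iff.1 (by simpa using hz))

theorem integral_affine {w p q u : Ω → ℝ} (hw : Integrable w μ) (hp : Integrable p μ)
    (hq : Integrable q μ) (hu : Integrable u μ) (c r : ℝ) :
    Integrable (fun ω => w ω + r * (p ω + (-(c * q ω) - u ω))) μ ∧
      ∫ ω, w ω + r * (p ω + (-(c * q ω) - u ω)) ∂μ =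
        ∫ ω, w ω ∂μ + r * (∫ ω, p ω ∂μ + (-(c * ∫ ω, q ω ∂μ) - ∫ ω, u ω ∂μ)) := by
  have h1 : Integrable (fun ω => -(c * q ω)) μ := (hq.const_mul c).neg
  have h2 : Integrable (fun ω => -(c * q ω) - u ω) μ := h1.sub hu
  have h3 : Integrable (fun ω => p ω + (-(c * q ω) - u ω)) μ := hp.add h2
  refine ⟨hw.add (h3.const_mul r), ?_⟩
  rw [integral_add hw (h3.const_mul r), integral_const_mul, integral_add hp h2,
    integral_sub h1 hu, integral_neg, integral_const_mul]

/-- The growth condition for one integrable weight yields a weak Hadamard subderivative. -/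
theorem isWeakHadamardSubderivative_of_growthCondition [SigmaFinite μ] [μ.IsComplete]
    [MeasurableSpace E] [BorelSpace E]
    {f : Ω → E → EReal} (hf : Measurable (Function.uncurry f))
    {x₀ : Lp E 1 μ} (htop : integralFunctional μ f x₀ ≠ ⊤) (hbot : integralFunctional μ f x₀ ≠ ⊥)
    {xs : Ω → StrongDual ℝ E} (hxs : MemLinftyWeakStar μ xs) {α : Ω → ℝ} (hα : Integrable α μ)
    (hpos : ∀ ω, 0 < α ω) (hG : GrowthCondition μ f x₀ xs α) :
    IsWeakHadamardSubderivative μ f x₀ xs := by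
  obtain ⟨M, hM⟩ := hxs.exists_ae_norm_le
  obtain ⟨ℓ, hℓ⟩ := exists_strongDual_pairing hxs.1 hM
  refine ⟨ℓ, hℓ, fun S hS => ?_⟩
  have hαm : Measurable α := aemeasurable_iff_measurable.1 hα.aemeasurable
  have hv : Measurable fun ω => f ω (x₀ ω) :=
    hf.comp (measurable_id.prodMk (Lp.stronglyMeasurable x₀).measurable)
  obtain ⟨w, hw, hwi, hvw, hI⟩ := exists_integrable_of_upperIntegral_finite hv htop hbot
  obtain ⟨ψ, hψ, hψS⟩ := exists_isYoungFunction_of_mem_weakHadamardBornology hαm hpos hS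
  refine zero_le_liminf_of_forall_eventually fun δ hδ => ?_
  -- As `∫ φ ≤ 2` on `S`, the factor `δ / 4` costs at most `δ / 2`; the other half of `δ` is left
  -- for `u r`.
  obtain ⟨u, hu, hulim, hgrow⟩ := hG (fun ω e => α ω * ψ ((α ω)⁻¹ * ‖e‖))
    ⟨ψ, hψ.nonneg, hψ.map_zero, hψ.monotoneOn, hψ.convexOn, hψ.superlinear, fun _ _ => rfl⟩
    (δ / 4) (by positivity)
  have husmall : ∀ᶠ r in 𝓝[>] (0 : ℝ), eLpNorm (u r) 1 μ ≤ ENNReal.ofReal (δ / 2) :=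
    hulim.eventually (ge_mem_nhds (by positivity))
  filter_upwards [hu, husmall, hgrow, self_mem_nhdsWithin] with r hur hus hgr hr0
  have hr : 0 < r := hr0
  refine le_iInf₂ fun x hx => ?_
  have hφ0 : ∀ ω, 0 ≤ α ω * ψ ((α ω)⁻¹ * ‖x ω‖) := fun ω =>
    mul_nonneg (hpos ω).le (hψ.nonneg _ (mul_nonneg (inv_nonneg.2 (hpos ω).le) (norm_nonneg _)))
  have hφm : Measurable fun ω => α ω * ψ ((α ω)⁻¹ * ‖x ω‖) :=
    hαm.mul (hψ.measurable_comp (hαm.inv.mul (Lp.stronglyMeasurable x).norm.measurable)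
      fun ω => mul_nonneg (inv_nonneg.2 (hpos ω).le) (norm_nonneg _))
  have hφi : Integrable (fun ω => α ω * ψ ((α ω)⁻¹ * ‖x ω‖)) μ := by
    refine ⟨hφm.aestronglyMeasurable, ?_⟩
    rw [hasFiniteIntegral_iff_ofReal (ae_of_all _ hφ0)]
    exact (hψS x hx).trans_lt (by simp)
  have hφ2 : ∫ ω, α ω * ψ ((α ω)⁻¹ * ‖x ω‖) ∂μ ≤ 2 := by
    rw [integral_eq_lintegral_of_nonneg_ae (ae_of_all _ hφ0) hφm.aestronglyMeasurable]
    exact ENNReal.toReal_mono (by simp) (hψS x hx)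
  have hu2 : ∫ ω, u r ω ∂μ ≤ δ / 2 := by
    rw [integral_eq_lintegral_of_nonneg_ae hur.2 hur.1.aestronglyMeasurable]
    refine ENNReal.toReal_le_of_le_ofReal (by positivity) (le_trans ?_ hus)
    rw [eLpNorm_one_eq_lintegral_enorm]
    exact lintegral_ofReal_le_lintegral_enorm _
  have hpair := integrable_pairing hxs.1 hM x
  rw [diffQuot, show integralFunctional μ f x₀ = _ from hI, coe_le_quotient_sub_iff hr]
  refine le_upperIntegral fun g hg hfg => EReal.coe_le_coe_iff.2 ?_
  have hle : ∀ᵐ ω ∂μ, w ω + r * (xs ω (x ω) +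
      (-(δ / 4 * (α ω * ψ ((α ω)⁻¹ * ‖x ω‖))) - u r ω)) ≤ g ω := by
    filter_upwards [hvw, hfg, hgr, Lp.coeFn_add x₀ (r • x), Lp.coeFn_smul r x]
      with ω h1 h2 h3 h4 h5
    have h6 := h3 (x ω)
    rw [diffQuot_sub_clm h1 _ _ hr, coe_le_quotient_sub_iff hr] at h6
    rw [h4, Pi.add_apply, h5, Pi.smul_apply] at h2
    exact EReal.coe_le_coe_iff.1 (h6.trans h2)
  obtain ⟨hint, hval⟩ := integral_affine hwi hpair hφi hur.1 (δ / 4) r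
  have hmono := integral_mono_ae hint hg hle
  rw [hval, ← hℓ] at hmono
  refine le_trans ?_ hmono
  gcongr
  nlinarith

end Sufficiency


/-! ### Separability of duals of reflexive spaces. -/

section SeparableDual

/-- A normed space with separable dual is separable. -/
theorem separableSpace_of_separableSpace_strongDual (X : Type*) [NormedAddCommGroup X]
    [NormedSpace ℝ X] [TopologicalSpace.SeparableSpace (StrongDual ℝ X)] :
    TopologicalSpace.SeparableSpace X := by
  let φ : ℕ → StrongDual ℝ X := TopologicalSpace.denseSeq _
  have hx : ∀ n, ∃ x : X, ‖x‖ ≤ 1 ∧ ‖φ n‖ / 2 ≤ |φ n x| := by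
    intro n
    by_contra! h
    have hle : ‖φ n‖ ≤ ‖φ n‖ / 2 :=
      ContinuousLinearMap.opNorm_le_of_unit_norm (by positivity) fun x hx => by
        simpa using (h x hx.le).le
    have h0 := h 0 (by simp)
    simp only [map_zero, abs_zero] at h0
    linarith
  choose x hx1 hx2 using hx
  -- A nonzero functional vanishing on `V` would be close to some `φ n`, which is nearly normed by
  -- `x n ∈ V`; this is impossible.
  let V := Submodule.span ℝ (range x)
  have hV : TopologicalSpace.IsSeparable (V : Set X) := (countable_range x).isSeparable.span
  have hdense : closure (V : Set X) = univ := by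
    by_contra hne
    obtain ⟨z, hz⟩ := (ne_univ_iff_exists_notMem _).1 hne
    obtain ⟨f, u, hfu, hu⟩ := geometric_hahn_banach_closed_point
      (V.convex.closure) isClosed_closure hz
    have hf0 : ∀ v ∈ V, f v = 0 := by
      intro v hv
      by_contra hfv
      have h1 := hfu _ (subset_closure (V.smul_mem (u / f v) hv))
      rw [map_smul, smul_eq_mul, div_mul_cancel₀ _ hfv] at h1
      exact lt_irrefl _ h1
    have hu0 : 0 < u := by simpa using hfu 0 (subset_closure V.zero_mem)
    have hfn : 0 < ‖f‖ := by
      rw [norm_pos_iff]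
      rintro rfl
      simp only [zero_apply] at hu
      linarith
    obtain ⟨n, hn⟩ := (TopologicalSpace.denseRange_denseSeq (StrongDual ℝ X)).exists_dist_lt f
      (show 0 < ‖f‖ / 3 by positivity)
    rw [dist_eq_norm] at hn
    have h1 : ‖φ n‖ / 2 ≤ ‖f - φ n‖ := by
      have e : φ n (x n) = -((f - φ n) (x n)) := by
        simp [hf0 _ (Submodule.subset_span (mem_range_self n))]
      refine (hx2 n).trans ?_
      rw [e, abs_neg]
      simpa using (f - φ n).le_of_opNorm_le_of_le le_rfl (hx1 n)
    have h2 : ‖f‖ ≤ ‖f - φ n‖ + ‖φ n‖ := by simpa using norm_add_le (f - φ n) (φ n)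
    have : ‖f - φ n‖ < ‖f‖ / 3 := hn
    linarith
  have := hV.closure
  rw [hdense] at this
  exact TopologicalSpace.isSeparable_univ_iff.1 this

/-- Combined with the preceding result for `X = E*`, this makes `E*` separable. -/
theorem IsReflexiveSpace.separableSpace_bidual {E : Type*} [NormedAddCommGroup E] [NormedSpace ℝ E]
    [TopologicalSpace.SeparableSpace E] (hE : IsReflexiveSpace E) :
    TopologicalSpace.SeparableSpace (StrongDual ℝ (StrongDual ℝ E)) :=
  hE.denseRange.separableSpace (NormedSpace.inclusionInDoubleDual ℝ E).continuous

end SeparableDual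

/-! ### Measurability of dual-valued maps. -/

section Pettis

/-- Scalarly measurable maps into a separable dual space are strongly measurable. -/
theorem stronglyMeasurable_of_scalarly_measurable {Ω F : Type*} [MeasurableSpace Ω]
    [NormedAddCommGroup F] [NormedSpace ℝ F] [TopologicalSpace.SeparableSpace F]
    [TopologicalSpace.SeparableSpace (StrongDual ℝ F)]
    {y : Ω → StrongDual ℝ F} (hy : ∀ e, Measurable fun ω => y ω e) : StronglyMeasurable y := by
  borelize (StrongDual ℝ F)
  have : SecondCountableTopology (StrongDual ℝ F) :=
    UniformSpace.secondCountable_of_separable _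
  refine Measurable.stronglyMeasurable (measurable_of_isOpen fun U hU => ?_)
  let d : ℕ → F := TopologicalSpace.denseSeq F
  -- A closed dual ball is cut out by countably many scalar inequalities, and every open set is a
  -- countable union of such balls.
  have hball : ∀ (z : StrongDual ℝ F) (q : ℝ), MeasurableSet (y ⁻¹' Metric.closedBall z q) := by
    intro z q
    rcases lt_or_ge q 0 with hq | hq
    · rw [Metric.closedBall_eq_empty.2 hq]; simp
    have : y ⁻¹' Metric.closedBall z q = ⋂ n, {ω | |y ω (d n) - z (d n)| ≤ q * ‖d n‖} := by
      ext ω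
      simp only [mem_preimage, mem_closedBall_iff_norm, mem_iInter, mem_ofPred_eq]
      constructor
      · intro h n
        simpa using (y ω - z).le_of_opNorm_le h (d n)
      · intro h
        refine ContinuousLinearMap.opNorm_le_bound _ hq fun e => ?_
        have hc : IsClosed {e | ‖(y ω - z) e‖ ≤ q * ‖e‖} :=
          isClosed_le (by fun_prop) (by fun_prop)
        exact (TopologicalSpace.denseRange_denseSeq F).induction_on e hc fun n => by
          simpa using h n
    rw [this]
    exact .iInter fun n => measurableSet_le ((hy _).sub_const _).abs measurable_const
  let c : ℕ → StrongDual ℝ F := TopologicalSpace.denseSeq _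
  have hU' : U = ⋃ (p : ℕ × ℚ) (_ : Metric.closedBall (c p.1) p.2 ⊆ U),
      Metric.closedBall (c p.1) p.2 := by
    refine Subset.antisymm (fun z hz => ?_) (iUnion₂_subset fun p hp => hp)
    obtain ⟨ε, hε, hzU⟩ := Metric.isOpen_iff.1 hU z hz
    obtain ⟨n, hn⟩ := (TopologicalSpace.denseRange_denseSeq (StrongDual ℝ F)).exists_dist_lt z
      (half_pos hε)
    obtain ⟨q, hq1, hq2⟩ := exists_rat_btwn hn
    refine mem_iUnion₂.2 ⟨(n, q), fun v hv => hzU ?_, hq1.le⟩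
    have h1 : dist v (c n) ≤ q := hv
    have h2 : dist z (c n) < q := hq1
    rw [Metric.mem_ball]
    calc dist v z ≤ dist v (c n) + dist z (c n) := dist_triangle_right _ _ _
      _ < ε := by linarith
  rw [hU', preimage_iUnion₂]
  exact .iUnion fun p => .iUnion fun _ => hball _ _

end Pettis

/-! ### The dual of `L¹(ν, F)` for a finite measure. -/

section DualRepresentation

variable {Ω F : Type*} [MeasurableSpace Ω] {ν : Measure Ω} [IsFiniteMeasure ν]
  [NormedAddCommGroup F] [NormedSpace ℝ F]

/-- An additive function on a dense subgroup which is bounded by a multiple of the norm extends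
to a continuous linear functional. -/
theorem exists_strongDual_extending {D : AddSubgroup F} (hD : Dense (D : Set F)) {p : F → ℝ}
    {C : ℝ} (hC : 0 ≤ C) (hadd : ∀ a ∈ D, ∀ b ∈ D, p (a + b) = p a + p b)
    (hbd : ∀ a ∈ D, |p a| ≤ C * ‖a‖) :
    ∃ y : StrongDual ℝ F, ‖y‖ ≤ C ∧ ∀ a ∈ D, y a = p a := by
  -- Additivity and boundedness give a Lipschitz map, which extends to `F`; a continuous additive
  -- map is real linear.
  have hlip : LipschitzOnWith C.toNNReal p D := by
    refine LipschitzOnWith.of_dist_le_mul fun a ha b hb => ?_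
    have h1 := hadd (a - b) (D.sub_mem ha hb) b hb
    rw [sub_add_cancel] at h1
    rw [Real.dist_eq, h1, add_sub_cancel_right, dist_eq_norm, Real.coe_toNNReal _ hC]
    exact hbd _ (D.sub_mem ha hb)
  obtain ⟨g, hg, hgp⟩ := hlip.extend_real
  have hgadd : (fun q : F × F => g (q.1 + q.2)) = fun q => g q.1 + g q.2 := by
    refine Continuous.ext_on (hD.prod hD) (hg.continuous.comp continuous_add)
      ((hg.continuous.comp continuous_fst).add (hg.continuous.comp continuous_snd)) ?_
    rintro ⟨a, b⟩ ⟨ha, hb⟩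
    simp only
    rw [← hgp ha, ← hgp hb, ← hgp (D.add_mem ha hb)]
    exact hadd a ha b hb
  let G : F →+ ℝ := AddMonoidHom.mk' g fun a b => congrFun hgadd (a, b)
  refine ⟨G.toRealLinearMap hg.continuous, ?_, fun a ha => (hgp ha).symm⟩
  refine ContinuousLinearMap.opNorm_le_bound _ hC fun x => ?_
  have h0 : g 0 = 0 := G.map_zero
  have := hg.dist_le_mul x 0
  rw [h0, dist_zero_right, dist_zero_right, Real.coe_toNNReal _ hC] at this
  exact this

/-- The scalar densities of a functional on `L¹(ν, F)`. -/
theorem exists_density_of_strongDual_L1 (Λ : StrongDual ℝ (Lp F 1 ν)) (e : F) :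
    ∃ g : Ω → ℝ, Measurable g ∧ Integrable g ν ∧
      (∀ A (hA : MeasurableSet A),
        ∫ ω in A, g ω ∂ν = Λ (indicatorConstLp 1 hA (measure_ne_top ν A) e)) ∧
      ∀ᵐ ω ∂ν, |g ω| ≤ ‖Λ‖ * ‖e‖ := by
  -- Multiplication by the constant one includes `L²` in `L¹`, the measure being finite, so the
  -- density comes from the Riesz representation in `L²`.
  let one : Lp ℝ 2 ν := indicatorConstLp 2 .univ (measure_ne_top ν _) 1
  let T : Lp ℝ 2 ν →L[ℝ] Lp ℝ 1 ν := (ContinuousLinearMap.mul ℝ ℝ).holderL ν 2 2 1 one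
  let S : Lp ℝ 1 ν →L[ℝ] Lp F 1 ν := (ContinuousLinearMap.toSpanSingleton ℝ e).compLpL 1 ν
  have hST : ∀ A (hA : MeasurableSet A),
      S (T (indicatorConstLp 2 hA (measure_ne_top ν A) 1)) =
        indicatorConstLp 1 hA (measure_ne_top ν A) e := by
    intro A hA
    ext1
    filter_upwards [(ContinuousLinearMap.toSpanSingleton ℝ e).coeFn_compLpL
        (T (indicatorConstLp 2 hA (measure_ne_top ν A) 1)),
      (ContinuousLinearMap.mul ℝ ℝ).coeFn_holder (r := 1) one
        (indicatorConstLp 2 hA (measure_ne_top ν A) 1),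
      indicatorConstLp_coeFn (p := 2) (hs := hA) (hμs := measure_ne_top ν A) (c := (1 : ℝ)),
      indicatorConstLp_coeFn (p := 1) (hs := hA) (hμs := measure_ne_top ν A) (c := e),
      indicatorConstLp_coeFn (p := 2) (hs := .univ) (hμs := measure_ne_top ν univ) (c := (1 : ℝ))]
      with ω h1 h2 h3 h4 h5
    have h2' : T (indicatorConstLp 2 hA (measure_ne_top ν A) 1) ω = A.indicator 1 ω := by
      refine h2.trans ?_
      rw [h3, h5]
      simp [Pi.one_def]
    rw [h4]
    refine h1.trans ?_
    rw [h2']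
    by_cases h : ω ∈ A <;> simp [h]
  let g : Lp ℝ 2 ν := (InnerProductSpace.toDual ℝ (Lp ℝ 2 ν)).symm ((Λ.comp S).comp T)
  have hgi : Integrable g ν := (Lp.memLp g).integrable (by norm_num)
  have hgA : ∀ A (hA : MeasurableSet A),
      ∫ ω in A, g ω ∂ν = Λ (indicatorConstLp 1 hA (measure_ne_top ν A) e) := by
    intro A hA
    rw [← L2.inner_indicatorConstLp_one (𝕜 := ℝ) hA (measure_ne_top ν A) g, real_inner_comm,
      InnerProductSpace.toDual_symm_apply]
    simp only [ContinuousLinearMap.comp_apply]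
    rw [hST A hA]
  have hbound : ∀ A, MeasurableSet A → |∫ ω in A, g ω ∂ν| ≤ ∫ _ω in A, ‖Λ‖ * ‖e‖ ∂ν := by
    intro A hA
    rw [hgA A hA, setIntegral_const, smul_eq_mul]
    refine (Λ.le_opNorm _).trans ?_
    rw [norm_indicatorConstLp one_ne_zero ENNReal.one_ne_top]
    simp only [ENNReal.toReal_one, div_one, Real.rpow_one]
    exact le_of_eq (by ring)
  refine ⟨g, (Lp.stronglyMeasurable g).measurable, hgi, hgA, ?_⟩
  have h1 := ae_le_of_forall_setIntegral_le hgi (integrable_const (‖Λ‖ * ‖e‖))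
    fun A hA _ => (le_abs_self _).trans (hbound A hA)
  have h2 := ae_le_of_forall_setIntegral_le hgi.neg (integrable_const (‖Λ‖ * ‖e‖))
    fun A hA _ => by
      simp only [Pi.neg_apply]
      rw [integral_neg]
      exact (neg_le_abs _).trans (hbound A hA)
  filter_upwards [h1, h2] with ω a b
  exact abs_le'.2 ⟨a, b⟩

/-- Continuous functionals on `L¹(ν, F)` are given by bounded scalarly measurable maps with
values in the dual. -/
theorem exists_pairing_of_strongDual_L1 [TopologicalSpace.SeparableSpace F]
    (Λ : StrongDual ℝ (Lp F 1 ν)) :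
    ∃ y : Ω → StrongDual ℝ F, (∀ e, Measurable fun ω => y ω e) ∧ (∀ ω, ‖y ω‖ ≤ ‖Λ‖) ∧
      ∀ x : Lp F 1 ν, Λ x = ∫ ω, y ω (x ω) ∂ν := by
  classical
  choose g hgm hgi hgA hgb using exists_density_of_strongDual_L1 Λ
  -- The integer span of a dense sequence is a countable group, so additivity and the bounds hold on
  -- all of it off a single null set.
  let D : AddSubgroup F :=
    (Finsupp.linearCombination ℤ (TopologicalSpace.denseSeq F)).toAddMonoidHom.range
  have hDc : (D : Set F).Countable := countable_range _
  have hDd : Dense (D : Set F) := by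
    refine (TopologicalSpace.denseRange_denseSeq F).mono ?_
    rintro _ ⟨n, rfl⟩
    exact ⟨Finsupp.single n 1, by simp⟩
  have hadd : ∀ a b, g (a + b) =ᵐ[ν] fun ω => g a ω + g b ω := by
    intro a b
    refine Integrable.ae_eq_of_forall_setIntegral_eq _ _ (hgi _) ((hgi a).add (hgi b))
      fun A hA _ => ?_
    rw [integral_add (hgi a).integrableOn (hgi b).integrableOn, hgA _ A hA, hgA _ A hA,
      hgA _ A hA, ← map_add, indicatorConstLp_add]
  have hgood : ∀ᵐ ω ∂ν, (∀ a ∈ D, ∀ b ∈ D, g (a + b) ω = g a ω + g b ω) ∧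
      ∀ a ∈ D, |g a ω| ≤ ‖Λ‖ * ‖a‖ := by
    refine Filter.Eventually.and ?_ ((ae_ball_iff hDc).2 fun a _ => hgb a)
    exact (ae_ball_iff hDc).2 fun a _ => (ae_ball_iff hDc).2 fun b _ => hadd a b
  obtain ⟨G, hGsub, hGm, hG0⟩ := exists_measurable_superset_of_null (ae_iff.1 hgood)
  have hGgood : ∀ ω ∉ G, ∃ y : StrongDual ℝ F, ‖y‖ ≤ ‖Λ‖ ∧ ∀ a ∈ D, y a = g a ω := by
    intro ω hω
    have := by_contra fun h => hω (hGsub h)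
    exact exists_strongDual_extending hDd (norm_nonneg Λ) this.1 this.2
  choose! y hyn hyD using hGgood
  let z : Ω → StrongDual ℝ F := fun ω => if ω ∈ G then 0 else y ω
  have hzn : ∀ ω, ‖z ω‖ ≤ ‖Λ‖ := fun ω => by
    by_cases h : ω ∈ G
    · simp [z, h]
    · simpa [z, h] using hyn ω h
  have hzD : ∀ a ∈ D, (fun ω => z ω a) = Gᶜ.indicator (g a) := fun a ha => by
    ext ω
    by_cases h : ω ∈ G
    · simp [z, h]
    · simpa [z, h] using hyD ω h a ha
  have hzm : ∀ e, Measurable fun ω => z ω e := by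
    intro e
    obtain ⟨a, haD, ha⟩ := mem_closure_iff_seq_limit.1 (hDd e)
    refine measurable_of_tendsto_metrizable (f := fun n ω => z ω (a n)) (fun n => ?_) ?_
    · rw [hzD _ (haD n)]
      exact (hgm _).indicator hGm.compl
    · rw [tendsto_pi_nhds]
      exact fun ω => ((z ω).continuous.tendsto e).comp ha
  refine ⟨z, hzm, hzn, ?_⟩
  obtain ⟨Λ', hΛ'⟩ := exists_strongDual_pairing (μ := ν) hzm (ae_of_all _ hzn)
  suffices h : ∀ x, Λ x = Λ' x from fun x => (h x).trans (hΛ' x)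
  have hind : ∀ A (hA : MeasurableSet A) (e : F),
      Λ (indicatorConstLp 1 hA (measure_ne_top ν A) e) =
        Λ' (indicatorConstLp 1 hA (measure_ne_top ν A) e) := by
    intro A hA e
    have hcont : Continuous fun e : F => indicatorConstLp 1 hA (measure_ne_top ν A) e := by
      refine (AddMonoidHomClass.continuous_of_bound (AddMonoidHom.mk'
        (fun e : F => indicatorConstLp 1 hA (measure_ne_top ν A) e)
        fun a b => (indicatorConstLp_add).symm) (ν.real A) fun e => ?_ :)
      simp only [AddMonoidHom.mk'_apply]
      rw [norm_indicatorConstLp one_ne_zero ENNReal.one_ne_top, mul_comm]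
      simp
    refine congrFun (Continuous.ext_on hDd (Λ.continuous.comp hcont) (Λ'.continuous.comp hcont)
      fun a ha => ?_) e
    simp only [Function.comp_apply]
    rw [← hgA a A hA, hΛ', ← integral_indicator hA]
    refine integral_congr_ae ?_
    have hG : ∀ᵐ ω ∂ν, ω ∉ G := by simpa [ae_iff] using hG0
    filter_upwards [hG, indicatorConstLp_coeFn (p := 1) (hs := hA)
      (hμs := measure_ne_top ν A) (c := a)] with ω h1 h2
    rw [h2]
    have := congrFun (hzD a ha) ω
    rw [indicator_of_mem (by exact h1)] at this
    by_cases h : ω ∈ A <;> simp [h, this]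
  intro x
  induction x using Lp.induction (by simp : (1 : ℝ≥0∞) ≠ ∞) with
  | indicatorConst c hs hμs =>
    rw [Lp.simpleFunc.coe_indicatorConst]
    exact hind _ hs c
  | add hf hg _ h1 h2 => rw [map_add, map_add, h1, h2]
  | isClosed => exact isClosed_eq Λ.continuous Λ'.continuous

end DualRepresentation


/-! ### Extraction and approximation of weakly convergent sequences. -/

section WeakSequences

/-- Diagonal form of the sequential Banach-Alaoglu theorem. -/
theorem exists_subseq_forall_tendsto_strongDual {Y : Type*} [NormedAddCommGroup Y]
    [NormedSpace ℝ Y] [TopologicalSpace.SeparableSpace Y] (Λ : ℕ → ℕ → StrongDual ℝ Y)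
    {C : ℕ → ℝ} (hΛ : ∀ c n, ‖Λ c n‖ ≤ C c) :
    ∃ s : ℕ → ℕ, StrictMono s ∧ ∀ c, ∃ M : StrongDual ℝ Y,
      ∀ y, Tendsto (fun k => Λ c (s k) y) atTop (𝓝 (M y)) := by
  -- The balls are weak-* compact and metrizable, hence so is their countable product; one
  -- subsequence serves all `c`.
  let B : ℕ → Set (WeakDual ℝ Y) := fun c =>
    WeakDual.toStrongDual ⁻¹' Metric.closedBall (0 : StrongDual ℝ Y) (C c)
  have hB : ∀ c, IsCompact (B c) := fun c => WeakDual.isCompact_closedBall _ _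
  have hc : ∀ c, CompactSpace (B c) := fun c => isCompact_iff_compactSpace.1 (hB c)
  have hm : ∀ c, TopologicalSpace.MetrizableSpace (B c) := fun c =>
    WeakDual.metrizable_of_isCompact ℝ Y _ (hB c)
  let u : ℕ → ∀ c, B c := fun n c => ⟨StrongDual.toWeakDual (Λ c n), by
    simpa [B, mem_closedBall_zero_iff] using hΛ c n⟩
  obtain ⟨M, s, hs, hlim⟩ := CompactSpace.tendsto_subseq u
  refine ⟨s, hs, fun c => ⟨WeakDual.toStrongDual (M c : WeakDual ℝ Y), fun y => ?_⟩⟩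
  have h1 := (tendsto_pi_nhds.1 hlim) c
  have h2 := (continuous_subtype_val.tendsto (M c)).comp h1
  exact ((WeakDual.eval_continuous y).tendsto _).comp h2

variable {X : Type*} [NormedAddCommGroup X] [NormedSpace ℝ X]

theorem norm_le_of_weak_tendsto {v : ℕ → X} {z : X}
    (h : ∀ ℓ : StrongDual ℝ X, Tendsto (fun k => ℓ (v k)) atTop (𝓝 (ℓ z))) {B : ℝ}
    (hB : ∀ k, ‖v k‖ ≤ B) : ‖z‖ ≤ B := by
  obtain ⟨ℓ, hℓ1, hℓ⟩ := exists_dual_vector'' ℝ z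
  have hz : ℓ z = ‖z‖ := by simpa using hℓ
  rw [← hz]
  refine le_of_tendsto' (h ℓ) fun k => (le_abs_self _).trans ?_
  have := ℓ.le_of_opNorm_le hℓ1 (v k)
  rw [one_mul, Real.norm_eq_abs] at this
  exact this.trans (hB k)

/-- A sequence uniformly approximated by weakly convergent sequences converges weakly. -/
theorem exists_weak_tendsto_of_approx [CompleteSpace X] {u : ℕ → X} {v : ℕ → ℕ → X} {z : ℕ → X}
    (hv : ∀ c, ∀ ℓ : StrongDual ℝ X, Tendsto (fun k => ℓ (v c k)) atTop (𝓝 (ℓ (z c))))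
    (happ : ∀ ε : ℝ, 0 < ε → ∃ c₀, ∀ c, c₀ ≤ c → ∀ k, ‖u k - v c k‖ ≤ ε) :
    ∃ x, ∀ ℓ : StrongDual ℝ X, Tendsto (fun k => ℓ (u k)) atTop (𝓝 (ℓ x)) := by
  -- The norm is weakly lower semicontinuous, so the limits inherit the uniform closeness of the
  -- approximants.
  have hcauchy : CauchySeq z := by
    refine Metric.cauchySeq_iff'.2 fun ε hε => ?_
    obtain ⟨c₀, hc₀⟩ := happ (ε / 3) (by positivity)
    refine ⟨c₀, fun c hc => ?_⟩
    rw [dist_eq_norm]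
    have : ‖z c - z c₀‖ ≤ ε / 3 + ε / 3 := by
      refine norm_le_of_weak_tendsto (v := fun k => v c k - v c₀ k) (fun ℓ => ?_) fun k => ?_
      · simpa using (hv c ℓ).sub (hv c₀ ℓ)
      · have e : v c k - v c₀ k = (u k - v c₀ k) - (u k - v c k) := by abel
        rw [e]
        exact (norm_sub_le _ _).trans (add_le_add (hc₀ c₀ le_rfl k) (hc₀ c hc k))
    linarith
  obtain ⟨x, hx⟩ := cauchySeq_tendsto_of_complete hcauchy
  refine ⟨x, fun ℓ => Metric.tendsto_atTop.2 fun ε hε => ?_⟩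
  have hη : 0 < ε / (4 * (‖ℓ‖ + 1)) := by positivity
  obtain ⟨c₀, hc₀⟩ := happ _ hη
  obtain ⟨c₁, hc₁⟩ := Metric.tendsto_atTop.1 hx _ hη
  let c := max c₀ c₁
  obtain ⟨K, hK⟩ := Metric.tendsto_atTop.1 (hv c ℓ) (ε / 4) (by positivity)
  refine ⟨K, fun k hk => ?_⟩
  have hℓη : ∀ a : X, ‖a‖ ≤ ε / (4 * (‖ℓ‖ + 1)) → |ℓ a| ≤ ε / 4 := fun a ha => by
    refine (ℓ.le_opNorm a).trans ?_
    calc ‖ℓ‖ * ‖a‖ ≤ (‖ℓ‖ + 1) * (ε / (4 * (‖ℓ‖ + 1))) := by gcongr; linarith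
      _ = ε / 4 := by field_simp
  have h1 := hℓη _ (hc₀ c (le_max_left _ _) k)
  have h2 := hℓη (z c - x) (by rw [← dist_eq_norm]; exact (hc₁ c (le_max_right _ _)).le)
  have h3 := hK k hk
  rw [Real.dist_eq] at h3 ⊢
  rw [map_sub] at h1 h2
  have e : ℓ (u k) - ℓ x = (ℓ (u k) - ℓ (v c k)) + (ℓ (v c k) - ℓ (z c)) + (ℓ (z c) - ℓ x) := by
    ring
  rw [e]
  have h4 := abs_add_three (ℓ (u k) - ℓ (v c k)) (ℓ (v c k) - ℓ (z c)) (ℓ (z c) - ℓ x)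
  linarith

end WeakSequences

/-! ### Weak compactness in `L¹(μ, E)` for reflexive `E`. -/

section DunfordPettis

theorem norm_le_of_forall_eq_pairing {Ω F : Type*} [MeasurableSpace Ω] {μ : Measure Ω}
    [NormedAddCommGroup F] [NormedSpace ℝ F] {y : Ω → StrongDual ℝ F} {M : ℝ} (hM0 : 0 ≤ M)
    (hM : ∀ᵐ ω ∂μ, ‖y ω‖ ≤ M) {ℓ : StrongDual ℝ (Lp F 1 μ)}
    (hℓ : ∀ x : Lp F 1 μ, ℓ x = ∫ ω, y ω (x ω) ∂μ) : ‖ℓ‖ ≤ M := by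
  refine ContinuousLinearMap.opNorm_le_bound _ hM0 fun x => ?_
  rw [hℓ, L1.norm_eq_integral_norm, ← integral_const_mul]
  refine norm_integral_le_of_norm_le ((L1.integrable_coeFn x).norm.const_mul M) ?_
  filter_upwards [hM] with ω hω
  exact (y ω).le_of_opNorm_le hω _

/-- For large `t` one has `ψ t ≥ (C / ε) t`, so on the exceptional set `‖x‖` is at most `ε / C`
times the Young integrand. -/
theorem exists_setLIntegral_le_of_lintegral_young_le {Ω E : Type*}
    [MeasurableSpace Ω] [NormedAddCommGroup E] {μ : Measure Ω} {α : Ω → ℝ} (hα : Measurable α) (hpos : ∀ ω, 0 < α ω) {ψ : ℝ → ℝ}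
    (hψ : IsYoungFunction ψ) {C : ℝ} (hC : 0 < C) {x : ℕ → Lp E 1 μ}
    (hx : ∀ n, ∫⁻ ω, ENNReal.ofReal (α ω * ψ ((α ω)⁻¹ * ‖x n ω‖)) ∂μ ≤ ENNReal.ofReal C)
    {ε : ℝ} (hε : 0 < ε) : ∃ c : ℕ, ∀ n,
      ∫⁻ ω in {ω | (c : ℝ) < (α ω)⁻¹ * ‖x n ω‖}, ‖x n ω‖ₑ ∂μ ≤ ENNReal.ofReal ε := by
  obtain ⟨t₀, ht₀⟩ := eventually_atTop.1
    ((hψ.superlinear.eventually_ge_atTop (C / ε)).and (eventually_gt_atTop 0))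
  obtain ⟨c, hc⟩ := exists_nat_ge t₀
  refine ⟨c, fun n => ?_⟩
  have hxm : Measurable fun ω => ‖x n ω‖ := (Lp.stronglyMeasurable (x n)).norm.measurable
  have hset : MeasurableSet {ω | (c : ℝ) < (α ω)⁻¹ * ‖x n ω‖} :=
    measurableSet_lt measurable_const (hα.inv.mul hxm)
  have hpt : ∀ ω ∈ {ω | (c : ℝ) < (α ω)⁻¹ * ‖x n ω‖}, ‖x n ω‖ₑ ≤
      ENNReal.ofReal (ε / C) * ENNReal.ofReal (α ω * ψ ((α ω)⁻¹ * ‖x n ω‖)) := by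
    intro ω hω
    have hlt : (c : ℝ) < (α ω)⁻¹ * ‖x n ω‖ := hω
    obtain ⟨h1, h2⟩ := ht₀ ((α ω)⁻¹ * ‖x n ω‖) (hc.trans hlt.le)
    rw [le_div_iff₀ h2, div_mul_eq_mul_div, div_le_iff₀ hε] at h1
    rw [← ofReal_norm, ← ENNReal.ofReal_mul (by positivity)]
    refine ENNReal.ofReal_le_ofReal ?_
    rw [div_mul_eq_mul_div, le_div_iff₀ hC]
    have h3 := mul_le_mul_of_nonneg_left h1 (hpos ω).le
    have h4 : α ω * (C * ((α ω)⁻¹ * ‖x n ω‖)) = ‖x n ω‖ * C := by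
      field_simp [(hpos ω).ne']
    linarith
  calc ∫⁻ ω in {ω | (c : ℝ) < (α ω)⁻¹ * ‖x n ω‖}, ‖x n ω‖ₑ ∂μ
      ≤ ∫⁻ ω in {ω | (c : ℝ) < (α ω)⁻¹ * ‖x n ω‖},
        ENNReal.ofReal (ε / C) * ENNReal.ofReal (α ω * ψ ((α ω)⁻¹ * ‖x n ω‖)) ∂μ :=
        setLIntegral_mono' hset hpt
    _ ≤ ∫⁻ ω, ENNReal.ofReal (ε / C) *
        ENNReal.ofReal (α ω * ψ ((α ω)⁻¹ * ‖x n ω‖)) ∂μ := setLIntegral_le_lintegral _ _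
    _ ≤ ENNReal.ofReal (ε / C) * ENNReal.ofReal C := by
        rw [lintegral_const_mul' _ _ ENNReal.ofReal_ne_top]
        gcongr
        exact hx n
    _ = ENNReal.ofReal ε := by
        rw [← ENNReal.ofReal_mul (by positivity), div_mul_cancel₀ _ hC.ne']

variable {E : Type*} [NormedAddCommGroup E] [NormedSpace ℝ E] [TopologicalSpace.SeparableSpace E]

theorem memLp_one_of_bound {Ω F : Type*} [MeasurableSpace Ω] {ν : Measure Ω} [IsFiniteMeasure ν]
    [NormedAddCommGroup F] {y : Ω → F} (hy : StronglyMeasurable y) {C : ℝ}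
    (hC : ∀ ω, ‖y ω‖ ≤ C) : MemLp y 1 ν :=
  MemLp.of_bound hy.aestronglyMeasurable C (ae_of_all _ hC)

/-- Sequences in `L¹(ν, E)` bounded in `L^∞`, with `E` reflexive: weak sequential compactness,
simultaneously for countably many sequences. -/
theorem exists_subseq_weak_tendsto_of_bounded {Z : Type*} [MeasurableSpace Z]
    [MeasurableSpace.CountablyGenerated Z] {ν : Measure Z} [IsFiniteMeasure ν]
    (hE : IsReflexiveSpace E) (v : ℕ → ℕ → Lp E 1 ν)
    (hv : ∀ c n : ℕ, ∀ᵐ ω ∂ν, ‖v c n ω‖ ≤ c) :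
    ∃ s : ℕ → ℕ, StrictMono s ∧ ∀ c, ∃ z : Lp E 1 ν, ∀ ℓ : StrongDual ℝ (Lp E 1 ν),
      Tendsto (fun k => ℓ (v c (s k))) atTop (𝓝 (ℓ z)) := by
  have := hE.separableSpace_bidual
  have : TopologicalSpace.SeparableSpace (StrongDual ℝ E) :=
    separableSpace_of_separableSpace_strongDual _
  let J := NormedSpace.inclusionInDoubleDual ℝ E
  have hJ : ∀ e, ‖J e‖ = ‖e‖ := (NormedSpace.inclusionInDoubleDualLi ℝ (E := E)).norm_map
  let I : E ≃ₗᵢ[ℝ] StrongDual ℝ (StrongDual ℝ E) :=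
    LinearIsometryEquiv.ofSurjective (NormedSpace.inclusionInDoubleDualLi ℝ) hE
  have hI : ∀ (a : StrongDual ℝ (StrongDual ℝ E)) (φ : StrongDual ℝ E), a φ = φ (I.symm a) := by
    intro a φ
    conv_lhs => rw [← I.apply_symm_apply a]
    rfl
  -- The bounded functions act on `L¹(ν, E*)`, which is separable because the σ-algebra is countably
  -- generated. A weak-* limit is represented by a bidual-valued map, brought back to `E` by
  -- reflexivity.
  have hΛ : ∀ c n : ℕ, ∃ Λ : StrongDual ℝ (Lp (StrongDual ℝ E) 1 ν), ‖Λ‖ ≤ c ∧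
      ∀ y : Lp (StrongDual ℝ E) 1 ν, Λ y = ∫ ω, y ω (v c n ω) ∂ν := by
    intro c n
    have hm : ∀ φ : StrongDual ℝ E, Measurable fun ω => J (v c n ω) φ := fun φ =>
      (φ.continuous.comp_stronglyMeasurable (Lp.stronglyMeasurable (v c n))).measurable
    have hb : ∀ᵐ ω ∂ν, ‖J (v c n ω)‖ ≤ c := by simpa only [hJ] using hv c n
    obtain ⟨Λ, hΛ⟩ := exists_strongDual_pairing hm hb
    exact ⟨Λ, norm_le_of_forall_eq_pairing (Nat.cast_nonneg c) hb hΛ, hΛ⟩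
  choose Λ hΛn hΛ using hΛ
  have : Fact ((1 : ℝ≥0∞) ≠ ∞) := ⟨ENNReal.one_ne_top⟩
  have : SecondCountableTopology (Lp (StrongDual ℝ E) 1 ν) := Lp.SecondCountableTopology
  obtain ⟨s, hs, hlim⟩ := exists_subseq_forall_tendsto_strongDual Λ hΛn
  refine ⟨s, hs, fun c => ?_⟩
  obtain ⟨M, hM⟩ := hlim c
  obtain ⟨Y, hYm, hYb, hY⟩ := exists_pairing_of_strongDual_L1 M
  have hzm : StronglyMeasurable fun ω => I.symm (Y ω) :=
    I.symm.continuous.comp_stronglyMeasurable (stronglyMeasurable_of_scalarly_measurable hYm)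
  have hz : MemLp (fun ω => I.symm (Y ω)) 1 ν :=
    memLp_one_of_bound hzm (C := ‖M‖) fun ω => by
      rw [I.symm.norm_map]; exact hYb ω
  refine ⟨hz.toLp, fun ℓ => ?_⟩
  -- A functional on `L¹(ν, E)` is a bounded `E*`-valued map, hence an element of `L¹(ν, E*)`
  -- against which the weak-* limit can be tested.
  obtain ⟨y, hym, hyb, hy⟩ := exists_pairing_of_strongDual_L1 ℓ
  have hyL : MemLp y 1 ν := memLp_one_of_bound (stronglyMeasurable_of_scalarly_measurable hym) hyb
  have e1 : ∀ n, ℓ (v c n) = Λ c n hyL.toLp := fun n => by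
    rw [hy, hΛ]
    refine integral_congr_ae ?_
    filter_upwards [hyL.coeFn_toLp] with ω h
    rw [h]
  have e2 : ℓ hz.toLp = M hyL.toLp := by
    rw [hy, hY]
    refine integral_congr_ae ?_
    filter_upwards [hyL.coeFn_toLp, hz.coeFn_toLp] with ω h1 h2
    rw [h1, h2, hI]
  simp_rw [e1, e2]
  exact hM _

/-- Uniformly integrable sequences in `L¹(ν, E)`, with `E` reflexive and the `σ`-algebra countably
generated, have weakly convergent subsequences. -/
theorem exists_subseq_weak_tendsto_of_uniformly_integrable [CompleteSpace E] {Z : Type*}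
    [MeasurableSpace Z] [MeasurableSpace.CountablyGenerated Z] {ν : Measure Z}
    [IsFiniteMeasure ν] (hE : IsReflexiveSpace E) (u : ℕ → Lp E 1 ν)
    (hu : ∀ ε : ℝ, 0 < ε → ∃ c : ℕ, ∀ n,
      ∫⁻ ω in {ω | (c : ℝ) < ‖u n ω‖}, ‖u n ω‖ₑ ∂ν ≤ ENNReal.ofReal ε) :
    ∃ s : ℕ → ℕ, StrictMono s ∧ ∃ z : Lp E 1 ν, ∀ ℓ : StrongDual ℝ (Lp E 1 ν),
      Tendsto (fun k => ℓ (u (s k))) atTop (𝓝 (ℓ z)) := by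
  have hA : ∀ (c n : ℕ), MeasurableSet {ω | (c : ℝ) < ‖u n ω‖} := fun c n =>
    measurableSet_lt measurable_const (Lp.stronglyMeasurable _).norm.measurable
  let v : ℕ → ℕ → Lp E 1 ν := fun c n => u n - restrictL1 _ (hA c n) (u n)
  have hv : ∀ c n : ℕ, ∀ᵐ ω ∂ν, ‖v c n ω‖ ≤ c := by
    intro c n
    filter_upwards [coeFn_restrictL1 (hA c n) (u n),
      Lp.coeFn_sub (u n) (restrictL1 _ (hA c n) (u n))] with ω h1 h2
    rw [h2, Pi.sub_apply, h1]
    by_cases h : (c : ℝ) < ‖u n ω‖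
    · rw [indicator_of_mem (by exact h)]; simp
    · rw [indicator_of_notMem (by exact h)]; simpa using h
  obtain ⟨s, hs, hlim⟩ := exists_subseq_weak_tendsto_of_bounded hE v hv
  choose z hz using hlim
  refine ⟨s, hs, exists_weak_tendsto_of_approx (v := fun c k => v c (s k)) hz fun ε hε => ?_⟩
  obtain ⟨c₀, hc₀⟩ := hu ε hε
  refine ⟨c₀, fun c hc k => ?_⟩
  have e : u (s k) - v c (s k) = restrictL1 _ (hA c (s k)) (u (s k)) := sub_sub_cancel _ _
  rw [e, ← ENNReal.ofReal_le_ofReal_iff hε.le, ofReal_norm, enorm_restrictL1]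
  refine le_trans (lintegral_mono_set fun ω hω => ?_) (hc₀ (s k))
  have h1 : (c₀ : ℝ) ≤ c := by exact_mod_cast hc
  exact h1.trans_lt hω

/-- Dunford-Pettis: for a reflexive space `E`, the elements of `L¹(μ, E)` with a bound on the
integral of a Young integrand form a sequentially relatively weakly compact set. -/
theorem setOf_lintegral_young_le_mem_weakHadamardBornology [CompleteSpace E] [MeasurableSpace E]
    [BorelSpace E] {Ω : Type*} [MeasurableSpace Ω] {μ : Measure Ω} (hE : IsReflexiveSpace E)
    {α : Ω → ℝ} (hα : Measurable α) (hαi : Integrable α μ) (hpos : ∀ ω, 0 < α ω) {ψ : ℝ → ℝ}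
    (hψ : IsYoungFunction ψ) {C : ℝ} (hC : 0 < C) :
    {x : Lp E 1 μ | ∫⁻ ω, ENNReal.ofReal (α ω * ψ ((α ω)⁻¹ * ‖x ω‖)) ∂μ ≤ ENNReal.ofReal C} ∈
      weakHadamardBornology (Lp E 1 μ) := by
  intro x hx
  have hUI : ∀ ε : ℝ, 0 < ε → ∃ c : ℕ, ∀ n,
      ∫⁻ ω in {ω | (c : ℝ) < (α ω)⁻¹ * ‖x n ω‖}, ‖x n ω‖ₑ ∂μ ≤ ENNReal.ofReal ε := fun ε hε =>
    exists_setLIntegral_le_of_lintegral_young_le hα hpos hψ hC hx hε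
  let a : Ω → NNReal := fun ω => (α ω).toNNReal
  have ha : Measurable a := hα.real_toNNReal
  let ν : Measure Ω := μ.withDensity fun ω => a ω
  have hν : IsFiniteMeasure ν := by
    refine isFiniteMeasure_withDensity ?_
    exact ((hasFiniteIntegral_iff_ofReal (ae_of_all _ fun ω => (hpos ω).le)).1 hαi.2).ne
  -- The σ-algebra of `Ω` need not be countably generated, so the whole sequence, divided by `α`, is
  -- transported to the sequence space `ℕ → E`, where it becomes the coordinate maps under a finite
  -- measure.
  let q : Ω → ℕ → E := fun ω n => (α ω)⁻¹ • x n ω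
  have hq : Measurable q := measurable_pi_lambda _ fun n =>
    hα.inv.smul (Lp.stronglyMeasurable (x n)).measurable
  let κ : Measure (ℕ → E) := ν.map q
  have hqκ : MeasurePreserving q ν κ := ⟨hq, rfl⟩
  have hcoord : ∀ n (g : ℝ → ℝ≥0∞), Measurable g → ∫⁻ p : ℕ → E, g ‖p n‖ ∂κ =
      ∫⁻ ω, a ω * g ((α ω)⁻¹ * ‖x n ω‖) ∂μ := by
    intro n g hg
    have h1 : Measurable fun p : ℕ → E => g ‖p n‖ := hg.comp (measurable_pi_apply n).norm
    rw [lintegral_map h1 hq]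
    refine (lintegral_withDensity_eq_lintegral_mul μ ha.coe_nnreal_ennreal (h1.comp hq)).trans
      (lintegral_congr fun ω => ?_)
    simp [q, norm_smul, abs_of_pos (hpos ω)]
  have haα : ∀ ω (b : ℝ), (a ω : ℝ≥0∞) * ENNReal.ofReal ((α ω)⁻¹ * b) = ENNReal.ofReal b := by
    intro ω b
    change ENNReal.ofReal (α ω) * _ = _
    rw [← ENNReal.ofReal_mul (hpos ω).le, mul_inv_cancel_left₀ (hpos ω).ne']
  have hpL : ∀ n, MemLp (fun p : ℕ → E => p n) 1 κ := by
    intro n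
    refine memLp_one_iff_integrable.2 ⟨(measurable_pi_apply n).aestronglyMeasurable, ?_⟩
    rw [hasFiniteIntegral_iff_norm, hcoord n ENNReal.ofReal ENNReal.measurable_ofReal]
    simp_rw [haα, ofReal_norm]
    exact (L1.integrable_coeFn (x n)).2
  let z : ℕ → Lp E 1 κ := fun n => (hpL n).toLp
  have hzc : ∀ n, z n =ᵐ[κ] fun p => p n := fun n => (hpL n).coeFn_toLp
  have hpUI : ∀ ε : ℝ, 0 < ε → ∃ c : ℕ, ∀ n,
      ∫⁻ p in {p | (c : ℝ) < ‖z n p‖}, ‖z n p‖ₑ ∂κ ≤ ENNReal.ofReal ε := by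
    intro ε hε
    obtain ⟨c, hc⟩ := hUI ε hε
    refine ⟨c, fun n => le_trans (le_of_eq ?_) (hc n)⟩
    have hset : MeasurableSet {ω | (c : ℝ) < (α ω)⁻¹ * ‖x n ω‖} :=
      measurableSet_lt measurable_const (hα.inv.mul (Lp.stronglyMeasurable (x n)).norm.measurable)
    rw [← lintegral_indicator (measurableSet_lt measurable_const
        (Lp.stronglyMeasurable _).norm.measurable),
      ← lintegral_indicator hset]
    have h1 : ∫⁻ p, {p | (c : ℝ) < ‖z n p‖}.indicator (fun p => ‖z n p‖ₑ) p ∂κ =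
        ∫⁻ p : ℕ → E, (Ioi (c : ℝ)).indicator ENNReal.ofReal ‖p n‖ ∂κ := by
      refine lintegral_congr_ae ?_
      filter_upwards [hzc n] with p hp
      simp only [indicator, mem_ofPred_eq, hp, mem_Ioi, ofReal_norm]
    rw [h1, hcoord n _ (ENNReal.measurable_ofReal.indicator measurableSet_Ioi)]
    refine lintegral_congr fun ω => ?_
    by_cases h : (c : ℝ) < (α ω)⁻¹ * ‖x n ω‖
    · rw [indicator_of_mem (by exact h), indicator_of_mem (by exact h), haα, ofReal_norm]
    · rw [indicator_of_notMem (by exact h), indicator_of_notMem (by exact h), mul_zero]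
  obtain ⟨s, hs, z₀, hz⟩ := exists_subseq_weak_tendsto_of_uniformly_integrable hE
    z hpUI
  -- Composition with `q` followed by multiplication by `α` carries the coordinates back to `x n`;
  -- being continuous and linear, it preserves weak convergence.
  let T : Lp E 1 κ →L[ℝ] Lp E 1 μ :=
    (withDensitySMulLI (E := E) μ ha).toContinuousLinearMap.comp
      (Lp.compMeasurePreservingₗᵢ ℝ q hqκ).toContinuousLinearMap
  have hT : ∀ n, T (z n) = x n := by
    intro n
    ext1
    have h1 : ∀ᵐ ω ∂ν, Lp.compMeasurePreservingₗᵢ ℝ q hqκ (z n) ω = q ω n :=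
      ((hpL n).comp_measurePreserving hqκ).coeFn_toLp
    have h2 := (ae_withDensity_iff ha.coe_nnreal_ennreal).1 h1
    have h3 := (memL1_smul_of_L1_withDensity ha
      (Lp.compMeasurePreservingₗᵢ ℝ q hqκ (z n))).coeFn_toLp
    filter_upwards [h2, h3] with ω h2 h3
    have h4 : T (z n) ω =
        a ω • Lp.compMeasurePreservingₗᵢ ℝ q hqκ (z n) ω := h3
    have ha0 : (a ω : ℝ≥0∞) ≠ 0 := by simp [a, hpos ω]
    rw [h4, h2 ha0, NNReal.smul_def]
    simp only [a, q, Real.coe_toNNReal _ (hpos ω).le]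
    rw [smul_inv_smul₀ (hpos ω).ne']
  refine ⟨T z₀, s, hs, tendsto_toWeakSpace_iff.2 fun ℓ => ?_⟩
  have := hz (ℓ.comp T)
  simp only [ContinuousLinearMap.comp_apply, hT] at this
  exact this

end DunfordPettis


/-! ### From the subderivative to the growth condition. -/

section Necessity

/-- Choosing for each `r` an admissible element whose size is within `r` of the infimum gives one
family that works for all `δ`. -/
theorem exists_family_tendsto_zero {A : Type*} [Nonempty A] {Q : ℝ → A → Prop} {N : A → ℝ≥0∞}
    (h : ∀ δ : ℝ, 0 < δ → ∀ᶠ r in 𝓝[>] (0 : ℝ), ∃ a, Q r a ∧ N a ≤ ENNReal.ofReal δ) :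
    ∃ a : ℝ → A, (∀ᶠ r in 𝓝[>] (0 : ℝ), Q r (a r)) ∧
      Tendsto (fun r => N (a r)) (𝓝[>] (0 : ℝ)) (𝓝 0) := by
  have key : ∀ r : ℝ, ∃ a, 0 < r → ∀ b, Q r b → Q r a ∧ N a ≤ N b + ENNReal.ofReal r := by
    intro r
    by_cases hex : ∃ b, Q r b ∧ N b ≠ ∞
    · obtain ⟨b₀, hb₀, hb₀'⟩ := hex
      let c := ⨅ (b) (_ : Q r b), N b
      have hc : c ≠ ∞ := ne_top_of_le_ne_top hb₀' (iInf₂_le b₀ hb₀)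
      by_cases hr : 0 < r
      · have hlt : c < c + ENNReal.ofReal r :=
          ENNReal.lt_add_right hc (ENNReal.ofReal_pos.2 hr).ne'
        obtain ⟨a, ha'⟩ := iInf_lt_iff.1 hlt
        obtain ⟨ha, hca⟩ := iInf_lt_iff.1 ha'
        exact ⟨a, fun _ b hb => ⟨ha, hca.le.trans (by gcongr; exact iInf₂_le b hb)⟩⟩
      · exact ⟨b₀, fun h => absurd h hr⟩
    · push Not at hex
      by_cases hb : ∃ b, Q r b
      · obtain ⟨b₀, hb₀⟩ := hb
        exact ⟨b₀, fun _ b hb => ⟨hb₀, by simp [hex b hb]⟩⟩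
      · exact ⟨Classical.arbitrary A, fun _ b h => absurd ⟨b, h⟩ hb⟩
  choose a ha using key
  refine ⟨a, ?_, ENNReal.tendsto_nhds_zero.2 fun η hη => ?_⟩
  · filter_upwards [h 1 one_pos, self_mem_nhdsWithin] with r ⟨b, hb, _⟩ hr
    exact (ha r hr b hb).1
  · obtain ⟨δ, hδ, hδη⟩ : ∃ δ : ℝ, 0 < δ ∧ ENNReal.ofReal (δ + δ) ≤ η := by
      obtain rfl | hη' := eq_or_ne η ∞
      · exact ⟨1, one_pos, le_top⟩
      · have := ENNReal.toReal_pos hη.ne' hη'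
        exact ⟨η.toReal / 2, by positivity, by rw [add_halves, ENNReal.ofReal_toReal hη']⟩
    have hsmall : ∀ᶠ r in 𝓝[>] (0 : ℝ), r < δ := nhdsWithin_le_nhds (Iio_mem_nhds hδ)
    filter_upwards [h δ hδ, self_mem_nhdsWithin, hsmall] with r ⟨b, hb, hbδ⟩ hr hrδ
    refine (ha r hr b hb).2.trans (le_trans ?_ hδη)
    rw [ENNReal.ofReal_add hδ.le hδ.le]
    exact add_le_add hbδ (ENNReal.ofReal_le_ofReal hrδ.le)

variable {Ω E : Type*} [MeasurableSpace Ω] {μ : Measure Ω} [NormedAddCommGroup E]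
  [NormedSpace ℝ E]

/-- An integrand which is below an affine one along `x` by more than `δ` contradicts a lower bound
for the integral functional on a ball of the Young functional. -/
theorem lintegral_le_of_integralFunctional_ge [SecondCountableTopology E] [MeasurableSpace E]
    [BorelSpace E] (hμ : IsAtomless μ)
    {f : Ω → E → EReal} {x₀ : Lp E 1 μ} {w : Ω → ℝ} (hw : Integrable w μ)
    (hfw : ∀ᵐ ω ∂μ, f ω (x₀ ω) = ((w ω : ℝ) : EReal))
    {xs : Ω → StrongDual ℝ E} (hxs : MemLinftyWeakStar μ xs)
    {α : Ω → ℝ} (hα : Measurable α) (hαi : Integrable α μ) (hpos : ∀ ω, 0 < α ω) {ψ : ℝ → ℝ}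
    (hψ : IsYoungFunction ψ) {ε δ r : ℝ} (hε : 0 < ε) (hδε : δ < ε) (hr : 0 < r)
    (hS : ∀ x : Lp E 1 μ, ∫⁻ ω, ENNReal.ofReal (α ω * ψ ((α ω)⁻¹ * ‖x ω‖)) ∂μ ≤ 1 →
      ((∫ ω, w ω ∂μ + r * (∫ ω, xs ω (x ω) ∂μ + -δ) : ℝ) : EReal) ≤
        integralFunctional μ f (x₀ + r • x))
    {x : Ω → E} (hx : Measurable x) {g : Ω → NNReal} (hg : Measurable g)
    (hfg : ∀ᵐ ω ∂μ, f ω (x₀ ω + r • x ω) ≤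
      ((w ω + r * (xs ω (x ω) + (-(ε * (α ω * ψ ((α ω)⁻¹ * ‖x ω‖))) - g ω)) : ℝ) : EReal)) :
    ∫⁻ ω, g ω ∂μ ≤ ENNReal.ofReal δ := by
  by_contra! hlt
  obtain ⟨M, hM⟩ := hxs.exists_ae_norm_le
  let φ : Ω → ℝ := fun ω => α ω * ψ ((α ω)⁻¹ * ‖x ω‖)
  have hφ0 : ∀ ω, 0 ≤ φ ω := fun ω =>
    mul_nonneg (hpos ω).le (hψ.nonneg _ (mul_nonneg (inv_nonneg.2 (hpos ω).le) (norm_nonneg _)))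
  have hφm : Measurable φ := hα.mul (hψ.measurable_comp (hα.inv.mul hx.norm)
    fun ω => mul_nonneg (inv_nonneg.2 (hpos ω).le) (norm_nonneg _))
  -- On `C N` both `x` and `g` are dominated by `N * α`, hence integrable, and so is the Young
  -- integrand.
  let C : ℕ → Set Ω := fun N => {ω | ‖x ω‖ ≤ N * α ω} ∩ {ω | (g ω : ℝ) ≤ N * α ω}
  have hC : ∀ N, MeasurableSet (C N) := fun N =>
    (measurableSet_le hx.norm (hα.const_mul _)).inter
      (measurableSet_le hg.coe_nnreal_real (hα.const_mul _))
  have hCmono : Monotone C := by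
    intro N N' hN ω hω
    have h1 : (N : ℝ) * α ω ≤ N' * α ω :=
      mul_le_mul_of_nonneg_right (by exact_mod_cast hN) (hpos ω).le
    exact ⟨le_trans hω.1 h1, le_trans hω.2 h1⟩
  have hCU : ⋃ N, C N = univ := by
    refine eq_univ_of_forall fun ω => mem_iUnion.2 ?_
    obtain ⟨N, hN⟩ := exists_nat_ge (max (‖x ω‖ / α ω) (g ω / α ω))
    have h1 := (le_max_left _ _).trans hN
    have h2 := (le_max_right _ _).trans hN
    rw [div_le_iff₀ (hpos ω)] at h1 h2
    exact ⟨N, h1, h2⟩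
  obtain ⟨N, hN⟩ : ∃ N, ENNReal.ofReal δ < ∫⁻ ω in C N, g ω ∂μ := by
    rw [← setLIntegral_univ, ← hCU, setLIntegral_iUnion_of_directed _ hCmono.directed_le] at hlt
    exact lt_iSup_iff.1 hlt
  have hαC : ∀ c : ℝ, Integrable (fun ω => c * α ω) μ := fun c => hαi.const_mul c
  have hφC : ∀ ω ∈ C N, φ ω ≤ ψ N * α ω := by
    intro ω hω
    refine (mul_le_mul_of_nonneg_left (hψ.monotoneOn (mem_Ici.2 ?_) (mem_Ici.2 N.cast_nonneg) ?_)
      (hpos ω).le).trans_eq (mul_comm _ _)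
    · exact mul_nonneg (inv_nonneg.2 (hpos ω).le) (norm_nonneg _)
    · rw [← div_eq_inv_mul, div_le_iff₀ (hpos ω)]
      exact hω.1
  have hint : ∀ {B : Set Ω}, MeasurableSet B → B ⊆ C N → ∀ {k : Ω → ℝ} (c : ℝ), Measurable k →
      (∀ ω ∈ C N, |k ω| ≤ c * α ω) → Integrable (B.indicator k) μ := by
    intro B hB hBC k c hk hkc
    rw [integrable_indicator_iff hB]
    refine (hαC c).integrableOn.mono' hk.aestronglyMeasurable ?_
    exact (ae_restrict_iff' hB).2 (ae_of_all _ fun ω hω => hkc ω (hBC hω))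
  have hφi : ∀ {B : Set Ω}, MeasurableSet B → B ⊆ C N → Integrable (B.indicator φ) μ :=
    fun hB hBC => hint hB hBC (ψ N) hφm fun ω hω => by
      rw [abs_of_nonneg (hφ0 ω)]; exact hφC ω hω
  have hgi : ∀ {B : Set Ω}, MeasurableSet B → B ⊆ C N →
      Integrable (B.indicator fun ω => (g ω : ℝ)) μ :=
    fun hB hBC => hint hB hBC N hg.coe_nnreal_real fun ω hω => by
      rw [NNReal.abs_eq]; exact hω.2
  have hval : ∀ {B : Set Ω} {k : Ω → ℝ}, MeasurableSet B → Integrable (B.indicator k) μ →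
      (∀ ω, 0 ≤ k ω) → ∫⁻ ω in B, ENNReal.ofReal (k ω) ∂μ =
        ENNReal.ofReal (∫ ω, B.indicator k ω ∂μ) := by
    intro B k hB hk hk0
    rw [integral_indicator hB, ofReal_integral_eq_lintegral_ofReal
      ((integrable_indicator_iff hB).1 hk) (ae_of_all _ hk0)]
  have hgval : ∀ {B : Set Ω}, MeasurableSet B → B ⊆ C N → ∫⁻ ω in B, g ω ∂μ =
      ENNReal.ofReal (∫ ω, B.indicator (fun ω => (g ω : ℝ)) ω ∂μ) := by
    intro B hB hBC
    rw [← hval hB (hgi hB hBC) fun ω => (g ω).2]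
    simp
  -- If `∫ φ ≤ 1` on `C N`, the excess of `∫ g` over `δ` suffices. Otherwise atomlessness cuts out
  -- `B` with `∫ φ = 1`, and `ε > δ` suffices.
  obtain ⟨B, hBC, hB, hBφ, hBδ⟩ : ∃ B ⊆ C N, MeasurableSet B ∧
      ∫⁻ ω in B, ENNReal.ofReal (φ ω) ∂μ ≤ 1 ∧
      δ < ε * ∫ ω, B.indicator φ ω ∂μ + ∫ ω, B.indicator (fun ω => (g ω : ℝ)) ω ∂μ := by
    have hpos1 : ∀ B : Set Ω, 0 ≤ ∫ ω, B.indicator φ ω ∂μ := fun B =>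
      integral_nonneg fun ω => indicator_nonneg (fun ω _ => hφ0 ω) ω
    have hpos2 : ∀ B : Set Ω, 0 ≤ ∫ ω, B.indicator (fun ω => (g ω : ℝ)) ω ∂μ := fun B =>
      integral_nonneg fun ω => indicator_nonneg (fun ω _ => (g ω).2) ω
    by_cases hle : ∫⁻ ω in C N, ENNReal.ofReal (φ ω) ∂μ ≤ 1
    · refine ⟨C N, Subset.rfl, hC N, hle, ?_⟩
      rw [hgval (hC N) Subset.rfl] at hN
      have h1 := lt_of_not_ge fun h => hN.not_ge (ENNReal.ofReal_le_ofReal h)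
      have h2 := mul_nonneg hε.le (hpos1 (C N))
      linarith
    · have hfin : ∫⁻ ω in C N, ENNReal.ofReal (φ ω) ∂μ ≠ ∞ := by
        rw [hval (hC N) (hφi (hC N) Subset.rfl) hφ0]
        exact ENNReal.ofReal_ne_top
      obtain ⟨B, hBC, hB, hB1⟩ := hμ.exists_subset_setLIntegral_eq hφm.ennreal_ofReal (hC N) hfin
        (not_le.1 hle).le
      refine ⟨B, hBC, hB, hB1.le, ?_⟩
      rw [hval hB (hφi hB hBC) hφ0, ENNReal.ofReal_eq_one] at hB1
      rw [hB1]
      linarith [hpos2 B]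
  have hz : MemLp (B.indicator x) 1 μ := by
    refine memLp_one_iff_integrable.2 ((integrable_indicator_iff hB).2 ?_)
    refine (hαC N).integrableOn.mono' hx.aestronglyMeasurable ?_
    exact (ae_restrict_iff' hB).2 (ae_of_all _ fun ω hω => (hBC hω).1)
  let z : Lp E 1 μ := hz.toLp
  have hzB : ∀ᵐ ω ∂μ, z ω = B.indicator x ω := hz.coeFn_toLp
  have hzS : ∫⁻ ω, ENNReal.ofReal (α ω * ψ ((α ω)⁻¹ * ‖z ω‖)) ∂μ ≤ 1 := by
    rw [← lintegral_indicator hB] at hBφ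
    refine le_trans (le_of_eq (lintegral_congr_ae ?_)) hBφ
    filter_upwards [hzB] with ω h
    rw [h]
    by_cases hω : ω ∈ B
    · simp only [indicator_of_mem hω, φ]
    · simp only [indicator_of_notMem hω, norm_zero, mul_zero, hψ.map_zero, ENNReal.ofReal_zero]
  obtain ⟨hai, hav⟩ := integral_affine hw (integrable_pairing hxs.1 hM z) (hφi hB hBC)
    (hgi hB hBC) ε r
  -- Off `B` the test function vanishes and the integrand equals `w`; the resulting upper bound
  -- falls below the assumed lower bound `-δ`.
  have hup := (hS _ hzS).trans (upperIntegral_le hai (by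
    filter_upwards [hfw, hfg, hzB, Lp.coeFn_add x₀ (r • z), Lp.coeFn_smul r z]
      with ω h1 h2 h3 h4 h5
    rw [h4, Pi.add_apply, h5, Pi.smul_apply, h3]
    by_cases hω : ω ∈ B
    · simpa only [indicator_of_mem hω] using h2
    · simp [indicator_of_notMem hω, h1]))
  rw [EReal.coe_le_coe_iff, hav] at hup
  nlinarith

/-- A lower bound for the integral functional on a ball of the Young functional gives a pointwise
growth condition with a small integrable error. -/
theorem exists_growth_of_integralFunctional_ge [SigmaFinite μ] [CompleteSpace E]
    [SecondCountableTopology E] [MeasurableSpace E] [BorelSpace E] (hμ : IsAtomless μ)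
    {f : Ω → E → EReal} (hf : Measurable (Function.uncurry f))
    {x₀ : Lp E 1 μ} {w : Ω → ℝ} (hwm : Measurable w) (hw : Integrable w μ)
    (hfw : ∀ᵐ ω ∂μ, f ω (x₀ ω) = ((w ω : ℝ) : EReal))
    {xs : Ω → StrongDual ℝ E} (hxs : MemLinftyWeakStar μ xs)
    {α : Ω → ℝ} (hα : Measurable α) (hαi : Integrable α μ) (hpos : ∀ ω, 0 < α ω) {ψ : ℝ → ℝ}
    (hψ : IsYoungFunction ψ) {ε δ r : ℝ} (hε : 0 < ε) (hδε : δ < ε) (hr : 0 < r)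
    (hS : ∀ x : Lp E 1 μ, ∫⁻ ω, ENNReal.ofReal (α ω * ψ ((α ω)⁻¹ * ‖x ω‖)) ∂μ ≤ 1 →
      ((∫ ω, w ω ∂μ + r * (∫ ω, xs ω (x ω) ∂μ + -δ) : ℝ) : EReal) ≤
        integralFunctional μ f (x₀ + r • x)) :
    ∃ u : Ω → ℝ, ((Integrable u μ ∧ ∀ᵐ ω ∂μ, 0 ≤ u ω) ∧ ∀ᵐ ω ∂μ, ∀ e : E,
      ((-(ε * (α ω * ψ ((α ω)⁻¹ * ‖e‖))) - u ω : ℝ) : EReal) ≤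
        diffQuot (fun e' => f ω e' - ((xs ω e' : ℝ) : EReal)) (x₀ ω) e r) ∧
      eLpNorm u 1 μ ≤ ENNReal.ofReal δ := by
  classical
  let b : Ω → E → ℝ → ℝ := fun ω e t =>
    w ω + r * (xs ω e + (-(ε * (α ω * ψ ((α ω)⁻¹ * ‖e‖))) - t))
  let V : Set (Ω → ℝ≥0∞) := {v | ∃ (g : Ω → NNReal) (x : Ω → E), Measurable g ∧ Measurable x ∧
    (v = fun ω => (g ω : ℝ≥0∞)) ∧
      ∀ᵐ ω ∂μ, f ω (x₀ ω + r • x ω) ≤ ((b ω (x ω) (g ω) : ℝ) : EReal)}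
  have h0 : ∀ᵐ ω ∂μ, f ω (x₀ ω + r • (0 : E)) ≤ ((b ω 0 0 : ℝ) : EReal) := by
    filter_upwards [hfw] with ω h
    simp [b, h, hψ.map_zero]
  have hV0 : (fun _ => ((0 : NNReal) : ℝ≥0∞)) ∈ V :=
    ⟨fun _ => 0, fun _ => 0, measurable_const, measurable_const, rfl, h0⟩
  have hVm : ∀ v ∈ V, Measurable v := by
    rintro _ ⟨g, x, hg, -, rfl, -⟩
    exact hg.coe_nnreal_ennreal
  have hVsup : ∀ v ∈ V, ∀ v' ∈ V, v ⊔ v' ∈ V := by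
    -- The larger gap is realised by following, at each point, the selection that produces it.
    rintro _ ⟨g, x, hg, hx, rfl, h⟩ _ ⟨g', x', hg', hx', rfl, h'⟩
    refine ⟨fun ω => max (g ω) (g' ω), {ω | g' ω ≤ g ω}.piecewise x x', hg.max hg',
      hx.piecewise (measurableSet_le hg' hg) hx', ?_, ?_⟩
    · ext ω
      simp
    · filter_upwards [h, h'] with ω h h'
      by_cases hω : g' ω ≤ g ω
      · rw [piecewise_eq_of_mem _ _ _ (by exact hω), max_eq_left hω]
        exact h
      · rw [piecewise_eq_of_notMem _ _ _ (by exact hω), max_eq_right (not_le.1 hω).le]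
        exact h'
  obtain ⟨u, hum, hui, hVu⟩ := exists_measurable_ae_upperBound μ ⟨_, hV0⟩ hVm hVsup
    (ENNReal.ofReal_ne_top (r := δ)) (by
      rintro _ ⟨g, x, hg, hx, rfl, h⟩
      exact lintegral_le_of_integralFunctional_ge hμ hw hfw hxs hα hαi hpos hψ hε hδε hr hS
        hx hg h)
  have hufin : ∫⁻ ω, u ω ∂μ ≠ ∞ := ne_top_of_le_ne_top ENNReal.ofReal_ne_top hui
  have hxsm : Measurable fun p : Ω × E => xs p.1 p.2 :=
    (measurable_uncurry_of_continuous_of_measurable (u := fun e ω => xs ω e)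
      (fun ω => (xs ω).continuous) hxs.1).comp measurable_swap
  have hbm : ∀ {t : Ω → ℝ}, Measurable t → Measurable fun p : Ω × E => b p.1 p.2 (t p.1) := by
    intro t ht
    have h1 : Measurable fun p : Ω × E => ψ ((α p.1)⁻¹ * ‖p.2‖) :=
      hψ.measurable_comp ((hα.comp measurable_fst).inv.mul measurable_snd.norm)
        fun p => mul_nonneg (inv_nonneg.2 (hpos _).le) (norm_nonneg _)
    exact (hwm.comp measurable_fst).add ((hxsm.add
      ((((hα.comp measurable_fst).mul h1).const_mul ε).neg.sub
        (ht.comp measurable_fst))).const_mul r)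
  have hfm : Measurable fun p : Ω × E => f p.1 (x₀ p.1 + r • p.2) :=
    hf.comp (measurable_fst.prodMk
      (((Lp.stronglyMeasurable x₀).measurable.comp measurable_fst).add
        (measurable_snd.const_smul r)))
  -- The margin `1 / (n + 1)` makes a selection violating the bound exceed `u` strictly; it is sent
  -- to zero at the end.
  let t : ℕ → Ω → NNReal := fun n ω => (u ω).toNNReal + ((n : NNReal) + 1)⁻¹
  have ht : ∀ n, Measurable (t n) := fun n => hum.ennreal_toNNReal.add_const _
  have hsel : ∀ n, ∀ᵐ ω ∂μ, ∀ e, (ω, e) ∉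
      {p : Ω × E | f p.1 (x₀ p.1 + r • p.2) ≤ ((b p.1 p.2 (t n p.1) : ℝ) : EReal)} := by
    intro n
    have hmeas : MeasurableSet {p : Ω × E | f p.1 (x₀ p.1 + r • p.2) ≤
        ((b p.1 p.2 (t n p.1) : ℝ) : EReal)} :=
      measurableSet_le hfm (measurable_coe_real_ereal.comp (hbm (ht n).coe_nnreal_real))
    refine ae_forall_notMem_of_selection μ hmeas fun x hx => ?_
    let D : Set Ω := {ω | f ω (x₀ ω + r • x ω) ≤ ((b ω (x ω) (t n ω) : ℝ) : EReal)}
    have hD : MeasurableSet D := (measurable_id.prodMk hx) hmeas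
    -- Off `D` the pair is replaced by direction zero and gap zero, which is always admissible.
    have hmem : (fun ω => ((D.indicator (t n) ω : NNReal) : ℝ≥0∞)) ∈ V := by
      refine ⟨D.indicator (t n), D.indicator x, (ht n).indicator hD, hx.indicator hD, rfl, ?_⟩
      filter_upwards [h0] with ω h
      by_cases hω : ω ∈ D
      · simp only [indicator_of_mem hω]
        exact hω
      · simp only [indicator_of_notMem hω]
        exact h
    filter_upwards [hVu _ hmem, ae_lt_top hum hufin] with ω h1 h2 (hω : ω ∈ D)
    simp only [indicator_of_mem hω] at h1
    rw [← ENNReal.coe_toNNReal h2.ne, ENNReal.coe_le_coe] at h1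
    exact absurd h1 (not_le.2 (lt_add_of_pos_right _ (by positivity)))
  refine ⟨fun ω => (u ω).toReal, ⟨⟨integrable_toReal_of_lintegral_ne_top hum.aemeasurable hufin,
    ae_of_all _ fun ω => ENNReal.toReal_nonneg⟩, ?_⟩, ?_⟩
  · filter_upwards [hfw, ae_all_iff.2 hsel] with ω h1 h2 e
    rw [diffQuot_sub_clm h1 _ _ hr, coe_le_quotient_sub_iff hr]
    have hlim : Tendsto (fun n : ℕ => ((b ω e (t n ω) : ℝ) : EReal)) atTop
        (𝓝 ((b ω e (u ω).toReal : ℝ) : EReal)) := by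
      have h3 : Tendsto (fun n : ℕ => (t n ω : ℝ)) atTop (𝓝 (u ω).toReal) := by
        have := (tendsto_one_div_add_atTop_nhds_zero_nat (𝕜 := ℝ)).const_add (u ω).toReal
        simpa [t, ENNReal.toReal] using this
      exact (continuous_coe_real_ereal.tendsto _).comp
        ((((h3.const_sub _).const_add _).const_mul r).const_add _)
    exact le_of_tendsto' hlim fun n => (not_le.1 (h2 n e)).le
  · rw [eLpNorm_one_eq_lintegral_enorm]
    refine le_trans (lintegral_mono fun ω => ?_) hui
    rw [Real.enorm_eq_ofReal ENNReal.toReal_nonneg]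
    exact ENNReal.ofReal_toReal_le

/-- A weak Hadamard subderivative satisfies the growth condition for every integrable weight. -/
theorem IsWeakHadamardSubderivative.growthCondition [SigmaFinite μ] [μ.IsComplete]
    [CompleteSpace E] [TopologicalSpace.SeparableSpace E] [MeasurableSpace E] [BorelSpace E]
    (hE : IsReflexiveSpace E) (hμ : IsAtomless μ)
    {f : Ω → E → EReal} (hf : Measurable (Function.uncurry f))
    {x₀ : Lp E 1 μ} (htop : integralFunctional μ f x₀ ≠ ⊤) (hbot : integralFunctional μ f x₀ ≠ ⊥)
    {xs : Ω → StrongDual ℝ E} (hxs : MemLinftyWeakStar μ xs)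
    (h : IsWeakHadamardSubderivative μ f x₀ xs) {α : Ω → ℝ} (hα : Integrable α μ)
    (hpos : ∀ ω, 0 < α ω) : GrowthCondition μ f x₀ xs α := by
  rintro φ ⟨ψ, h1, h2, h3, h4, h5, hφ⟩ ε hε
  have hψ : IsYoungFunction ψ := ⟨h1, h2, h3, h4, h5⟩
  obtain rfl : φ = fun ω e => α ω * ψ ((α ω)⁻¹ * ‖e‖) := funext₂ hφ
  obtain ⟨ℓ, hℓ, hsub⟩ := h
  have : SecondCountableTopology E := UniformSpace.secondCountable_of_separable E
  have hαm : Measurable α := aemeasurable_iff_measurable.1 hα.aemeasurable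
  have hv : Measurable fun ω => f ω (x₀ ω) :=
    hf.comp (measurable_id.prodMk (Lp.stronglyMeasurable x₀).measurable)
  obtain ⟨w, hw, hwi, hvw, hI⟩ := exists_integrable_of_upperIntegral_finite hv htop hbot
  have hlim := hsub _ (setOf_lintegral_young_le_mem_weakHadamardBornology hE hαm hα hpos hψ one_pos)
  obtain ⟨u, hu, hu0⟩ := exists_family_tendsto_zero (N := fun u : Ω → ℝ => eLpNorm u 1 μ)
    (Q := fun r u => (Integrable u μ ∧ ∀ᵐ ω ∂μ, 0 ≤ u ω) ∧ ∀ᵐ ω ∂μ, ∀ e : E,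
      ((-(ε * (α ω * ψ ((α ω)⁻¹ * ‖e‖))) - u ω : ℝ) : EReal) ≤
        diffQuot (fun e' => f ω e' - ((xs ω e' : ℝ) : EReal)) (x₀ ω) e r) (by
    intro δ hδ
    -- The gap estimate needs the tolerance strictly below `ε`.
    let δ' := min δ (ε / 2)
    have hδ' : 0 < δ' := lt_min hδ (by positivity)
    have hδε : δ' < ε := (min_le_right _ _).trans_lt (by linarith)
    have hneg : ((-δ' : ℝ) : EReal) < 0 := by exact_mod_cast neg_neg_of_pos hδ'
    filter_upwards [eventually_lt_of_lt_liminf (hneg.trans_le hlim), self_mem_nhdsWithin]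
      with r hrδ hr
    obtain ⟨u, hu, huδ⟩ := exists_growth_of_integralFunctional_ge hμ hf hw hwi hvw hxs hαm hα hpos
      hψ hε hδε hr fun x hx => by
        have hle := hrδ.le.trans (iInf₂_le x (by simpa using hx))
        rw [diffQuot, show integralFunctional μ f x₀ = _ from hI, coe_le_quotient_sub_iff hr,
          hℓ] at hle
        exact hle
    exact ⟨u, hu, huδ.trans (ENNReal.ofReal_le_ofReal (min_le_left _ _))⟩)
  exact ⟨u, hu.mono fun r h => h.1, hu0, hu.mono fun r h => h.2⟩

/-- This guarantees that the condition over all weights is not vacuous, and provides the weight for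
the existential version. -/
theorem exists_integrable_pos (μ : Measure Ω) [SigmaFinite μ] :
    ∃ α : Ω → ℝ, Integrable α μ ∧ ∀ ω, 0 < α ω := by
  obtain ⟨g, hg0, hg, hgi⟩ := exists_pos_lintegral_lt_of_sigmaFinite μ one_ne_zero
  refine ⟨fun ω => g ω, ⟨hg.coe_nnreal_real.aestronglyMeasurable, ?_⟩, fun ω => hg0 ω⟩
  rw [hasFiniteIntegral_iff_enorm]
  simpa using hgi.trans ENNReal.one_lt_top

end Necessity

end WeakHadamard

theorem corollary9p7 {Ω E : Type*} [MeasurableSpace Ω] (μ : Measure Ω) [SigmaFinite μ]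
    [μ.IsComplete] [NormedAddCommGroup E] [NormedSpace ℝ E] [CompleteSpace E]
    [TopologicalSpace.SeparableSpace E] [MeasurableSpace E] [BorelSpace E]
    (f : Ω → E → EReal) (hf : Measurable (Function.uncurry f))
    (x₀ : Lp E 1 μ) (hx₀_top : WeakHadamard.integralFunctional μ f x₀ ≠ ⊤)
    (hx₀_bot : WeakHadamard.integralFunctional μ f x₀ ≠ ⊥)
    (xs : Ω → StrongDual ℝ E) (hxs : WeakHadamard.MemLinftyWeakStar μ xs) :
    ((∀ α : Ω → ℝ, Integrable α μ → (∀ ω, 0 < α ω) →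
        WeakHadamard.GrowthCondition μ f x₀ xs α) →
      WeakHadamard.IsWeakHadamardSubderivative μ f x₀ xs) ∧
    ((∃ α : Ω → ℝ, Integrable α μ ∧ (∀ ω, 0 < α ω) ∧
        WeakHadamard.GrowthCondition μ f x₀ xs α) →
      WeakHadamard.IsWeakHadamardSubderivative μ f x₀ xs) ∧
    (WeakHadamard.IsReflexiveSpace E → WeakHadamard.IsAtomless μ →
      ((WeakHadamard.IsWeakHadamardSubderivative μ f x₀ xs ↔
        ∀ α : Ω → ℝ, Integrable α μ → (∀ ω, 0 < α ω) →
          WeakHadamard.GrowthCondition μ f x₀ xs α) ∧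
      (WeakHadamard.IsWeakHadamardSubderivative μ f x₀ xs ↔
        ∃ α : Ω → ℝ, Integrable α μ ∧ (∀ ω, 0 < α ω) ∧
          WeakHadamard.GrowthCondition μ f x₀ xs α))) := by
  have hb := fun (α : Ω → ℝ) (hα : MeasureTheory.Integrable α μ) (hpos : ∀ ω, 0 < α ω) =>
    WeakHadamard.isWeakHadamardSubderivative_of_growthCondition hf hx₀_top hx₀_bot hxs hα hpos
  obtain ⟨β, hβ, hβpos⟩ := WeakHadamard.exists_integrable_pos μ
  refine ⟨fun h => hb β hβ hβpos (h β hβ hβpos), fun ⟨α, hα, hpos, h⟩ => hb α hα hpos h,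
    fun hE hμ => ?_⟩
  have ha := fun (h : WeakHadamard.IsWeakHadamardSubderivative μ f x₀ xs) (α : Ω → ℝ)
      (hα : MeasureTheory.Integrable α μ) (hpos : ∀ ω, 0 < α ω) =>
    h.growthCondition hE hμ hf hx₀_top hx₀_bot hxs hα hpos
  exact ⟨⟨ha, fun h => hb β hβ hβpos (h β hβ hβpos)⟩,
    ⟨fun h => ⟨β, hβ, hβpos, ha h β hβ hβpos⟩, fun ⟨α, hα, hpos, h⟩ => hb α hα hpos h⟩⟩
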